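/- Let $\mathcal D$ be an irreducible rate matrix on a finite set $\mathsf X$, let $\mathcal U:\mathsf X\to\mathbb R$ and let $x\in\mathsf X$. For $T\ge 0$ let $p^0_T$ be the law, on the space of càdlàg paths $[0,T]\to\mathsf X$ with the $\sigma$-algebra generated by the coordinates, of the Markov process with generator $\mathcal D$ (transition semigroup $e^{t\mathcal D}$) started at $X_0=x$. For a probability measure $p$ on this path space define the $T$-stage welfare $$\mathcal W_T(p)=\mathsf E_p\Bigl[\int_0^T\mathcal U(X_t)\,dt\Bigr]-D(p\,\|\,p^0_T)\in[-\infty,\infty),$$ where $D$ is the Kullback–Leibler divergence. Let $I_{\mathcal U}=\mathrm{diag}(\mathcal U)$, and let $\Lambda$ be the largest real part of an eigenvalue of $\mathcal D+I_{\mathcal U}$. Then $\Lambda$ is itself an eigenvalue of $\mathcal D+I_{\mathcal U}$ (the Perron–Frobenius eigenvalue), and there is $v:\mathsf X\to(0,\infty)$ with $[\mathcal D+I_{\mathcal U}]v=\Lambda v$. Moreover: (i) For every $T\ge0$ the welfare $\mathcal W_T$ has a maximizer among all probability measures on the path space, and for any choice of maximizers $p^*_T$, $$\mathcal W^*_\infty:=\lim_{T\to\infty}\tfrac1T\mathcal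 W_T(p^*_T)=\Lambda .$$ Let $v:\mathsf X\to(0,\infty)$ be any solution of $[\mathcal D+I_{\mathcal U}]v=\Lambda v$, let $I_v=\mathrm{diag}(v)$, and put $$\check{\mathcal D}=I_v^{-1}[\mathcal D+I_{\mathcal U}-\Lambda I]I_v .$$ (ii) $\check{\mathcal D}$ is a rate matrix; for every $T\ge0$ there is exactly one law $\check p_T$ on the path space of the time-homogeneous Markov process with generator $\check{\mathcal D}$ started at $X_0=x$; and these laws attain the optimal average welfare: $\lim_{T\to\infty}\frac1T\mathcal W_T(\check p_T)=\Lambda=\mathcal W^*_\infty$. (iii) For every $T\ge 0$, $$\mathcal W_T(\check p_T)=T\Lambda-\mathsf E_{\check p_T}\Bigl[\log\frac{v(X_T)}{v(X_0)}\Bigr].$$ -/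

import Mathlib

open MeasureTheory Filter Topology
open scoped NNReal ENNReal Matrix

noncomputable section

/-- A rate matrix: the generator of a continuous-time Markov process on the finite set `S`. -/
structure IsRateMatrix {S : Type*} [Fintype S] (D : Matrix S S ℝ) : Prop where
  off_diag_nonneg : ∀ x y, x ≠ y → 0 ≤ D x y
  row_sum : ∀ x, ∑ y, D x y = 0

/-- Irreducibility: every state can be reached from every state along transitions
of positive rate. (The diagonal of a rate matrix is nonpositive, so only genuine jumps count.) -/
def IsIrreducibleRate {S : Type*} (D : Matrix S S ℝ) : Prop :=
  ∀ x y, Relation.ReflTransGen (fun a b => 0 < D a b) x y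

/-- The largest real part of a complex eigenvalue of the real matrix `M`. -/
def maxRealPart {S : Type*} [Fintype S] [DecidableEq S] (M : Matrix S S ℝ) : ℝ :=
  sSup (Complex.re '' spectrum ℂ (M.map (algebraMap ℝ ℂ)))

/-- Sample paths on `[0, T]` with values in the discrete set `S` that are right continuous and
have left limits. -/
structure CadlagPath (S : Type*) (T : ℝ≥0) where
  toFun : Set.Icc (0 : ℝ) T → S
  right_cont : ∀ t, ∀ᶠ s in 𝓝[≥] t, toFun s = toFun t
  left_lim : ∀ t, ∃ a, ∀ᶠ s in 𝓝[<] t, toFun s = a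

instance CadlagPath.instCoeFun {S : Type*} {T : ℝ≥0} :
    CoeFun (CadlagPath S T) (fun _ => Set.Icc (0 : ℝ) T → S) :=
  ⟨CadlagPath.toFun⟩

/-- The sigma-algebra generated by the process `X_t(ω) = ω t`, `0 ≤ t ≤ T`
(all subsets of `S` are measurable). -/
instance CadlagPath.instMeasurableSpace {S : Type*} {T : ℝ≥0} :
    MeasurableSpace (CadlagPath S T) :=
  ⨆ t : Set.Icc (0 : ℝ) T, MeasurableSpace.comap (fun ω : CadlagPath S T => ω t) ⊤

/-- The initial time, as a point of `[0, T]`. -/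
def startTime (T : ℝ≥0) : Set.Icc (0 : ℝ) T := ⟨0, le_rfl, T.coe_nonneg⟩

/-- The terminal time, as a point of `[0, T]`. -/
def endTime (T : ℝ≥0) : Set.Icc (0 : ℝ) T := ⟨T, T.coe_nonneg, le_rfl⟩

/-- `p` is the distribution on `[0, T]` of the time-homogeneous Markov process with generator `D`
(transition semigroup `P^t = exp (t D)`) and initial condition `X_0 = x`: for all
`0 = t_0 ≤ t_1 ≤ ⋯ ≤ t_n ≤ T` and all states `y_0, …, y_n`,
`p (X_{t_0} = y_0, …, X_{t_n} = y_n) = 1{y_0 = x} ∏_{i<n} P^{t_{i+1} - t_i} (y_i, y_{i+1})`. -/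
def IsMarkovLaw {S : Type*} [Fintype S] [DecidableEq S] (D : Matrix S S ℝ) (x : S) (T : ℝ≥0)
    (p : Measure (CadlagPath S T)) : Prop :=
  ∀ (n : ℕ) (t : Fin (n + 1) → Set.Icc (0 : ℝ) T) (y : Fin (n + 1) → S),
    Monotone t → t 0 = startTime T →
      p {ω | ∀ i, ω (t i) = y i} =
        ENNReal.ofReal ((if y 0 = x then 1 else 0) *
          ∏ i : Fin n, NormedSpace.exp (((t i.succ : ℝ) - (t i.castSucc : ℝ)) • D)
            (y i.castSucc) (y i.succ))

/-- The `T`-stage welfare `E_p[∫_0^T U(X_t) dt] - D(p ‖ p0)`, an extended real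
(it is `-∞` exactly when the divergence is infinite). The map `Set.projIcc` only regards
`t ∈ [0, T]` as a point of the index set of the path. -/
def welfare {S : Type*} {T : ℝ≥0} (U : S → ℝ) (p0 p : Measure (CadlagPath S T)) : EReal :=
  ((∫ ω, (∫ t in (0 : ℝ)..T, U (ω (Set.projIcc 0 (T : ℝ) T.coe_nonneg t))) ∂p : ℝ) : EReal) -
    ((InformationTheory.klDiv p p0 : ℝ≥0∞) : EReal)

/-- `p` maximizes the `T`-stage welfare among all probability measures on path space. -/
def IsWelfareOptimal {S : Type*} {T : ℝ≥0} (U : S → ℝ) (p0 p : Measure (CadlagPath S T)) : Prop :=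
  IsProbabilityMeasure p ∧
    ∀ q : Measure (CadlagPath S T), IsProbabilityMeasure q → welfare U p0 q ≤ welfare U p0 p

/-- `w` is the limit of `W_T / T` as `T → ∞`, where `W_T = welfare U (p0 T) (p T)`. -/
def HasAverageWelfare {S : Type*} (U : S → ℝ) (p0 p : ∀ T : ℝ≥0, Measure (CadlagPath S T))
    (w : ℝ) : Prop :=
  Tendsto (fun T : ℝ≥0 => welfare U (p0 T) (p T) / ((T : ℝ) : EReal)) atTop (𝓝 (w : EReal))

/-- The matrix `I_v⁻¹ [D + I_U - Λ I] I_v`. -/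
def twistedGenerator {S : Type*} [Fintype S] [DecidableEq S] (D : Matrix S S ℝ) (U : S → ℝ)
    (Λ : ℝ) (v : S → ℝ) : Matrix S S ℝ :=
  (Matrix.diagonal v)⁻¹ * (D + Matrix.diagonal U - Λ • (1 : Matrix S S ℝ)) * Matrix.diagonal v

end

/-! For a bounded path functional `f`, the Gibbs variational principle bounds `E_q[f] - D(q‖p)` by
`log E_p[e^f]`, the gap being the divergence of `q` from the tilt of `p` by `f`. With `f = ∫₀ᵀ
U(X_t) dt` the optimal welfare is therefore `log E_{p0}[exp ∫₀ᵀ U]`, attained by the tilt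
(`IsWelfareOptimal.welfare_eq`), and (i) asks for the growth rate of this expectation.

By the Feynman–Kac formula (`IsMarkovLaw.feynmanKac`) the weight `exp ∫ U` turns the semigroup of
`D` into that of `D + I_U`. Applied to a positive eigenvector `v` it gives `E[exp(∫₀ᵀ U) v(X_T)] =
e^{TΛ} v(x)`. Since `log v` is bounded on a finite set, dropping `v(X_T)` changes the logarithm by a
bounded amount, which disappears after division by `T`.

Tilting `p0` by `∫₀ᵀ U + log v(X_T)` instead is a Doob transform: on a cylinder the factors `v`
telescope, and the finite-dimensional distributions are those of the twisted generator
(`IsMarkovLaw.tilted_twistPotential`). This provides the twisted process without constructing it;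
uniqueness is a π-λ argument. As an explicit tilt it has an explicit divergence, in which the reward
cancels against the one in the welfare. What remains is (iii), and the bound on `log v` then gives
(ii).

Feynman–Kac itself comes from Riemann sums of the reward: the Markov property produces `(e^{hD}
e^{hU})^N`, whose limit is the Lie–Trotter formula. The eigenvector comes from Perron–Frobenius
after a shift of the diagonal. -/

/-! ### Perron–Frobenius theory for matrices with nonnegative off-diagonal entries -/

section PerronFrobenius

variable {S : Type*} [Fintype S] [DecidableEq S]

/-- A path from `i` to `j` with `k` steps makes the entry of `(1 + B) ^ k` positive. The entries are
nondecreasing in `k`, so the largest of finitely many exponents serves all pairs. -/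
lemma exists_one_add_pow_pos {B : Matrix S S ℝ} (hB : ∀ i j, 0 ≤ B i j)
    (hirr : ∀ i j, Relation.ReflTransGen (fun a b => 0 < B a b) i j) :
    ∃ k : ℕ, ∀ i j, 0 < ((1 + B) ^ k) i j := by
  have hN : ∀ i j, 0 ≤ (1 + B) i j := fun i j => by
    rw [Matrix.add_apply]
    exact add_nonneg (by rw [Matrix.one_apply]; split_ifs <;> norm_num) (hB i j)
  have hpow : ∀ (k : ℕ) i j, 0 ≤ ((1 + B) ^ k) i j := by
    intro k
    induction k with
    | zero => intro i j; rw [pow_zero, Matrix.one_apply]; split_ifs <;> norm_num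
    | succ k ih =>
      intro i j
      rw [pow_succ, Matrix.mul_apply]
      exact Finset.sum_nonneg fun l _ => mul_nonneg (ih i l) (hN l j)
  have hmono : ∀ i j, Monotone fun k : ℕ => ((1 + B) ^ k) i j := by
    intro i j
    refine monotone_nat_of_le_succ fun k => ?_
    rw [pow_succ, mul_add, mul_one, Matrix.add_apply, Matrix.mul_apply]
    exact le_add_of_nonneg_right
      (Finset.sum_nonneg fun l _ => mul_nonneg (hpow k i l) (hB l j))
  have hex : ∀ i j, ∃ k : ℕ, 0 < ((1 + B) ^ k) i j := by
    intro i j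
    induction hirr i j with
    | refl => exact ⟨0, by simp⟩
    | @tail b c _ hbc ih =>
      obtain ⟨k, hk⟩ := ih
      refine ⟨k + 1, ?_⟩
      rw [pow_succ, Matrix.mul_apply]
      refine lt_of_lt_of_le (mul_pos hk (?_ : 0 < (1 + B) b c))
        (Finset.single_le_sum (f := fun l => ((1 + B) ^ k) i l * (1 + B) l c)
          (fun l _ => mul_nonneg (hpow k i l) (hN l c)) (Finset.mem_univ b))
      rw [Matrix.add_apply]
      exact add_pos_of_nonneg_of_pos (by rw [Matrix.one_apply]; split_ifs <;> norm_num) hbc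
  choose k hk using hex
  refine ⟨Finset.univ.sup fun q : S × S => k q.1 q.2, fun i j => (hk i j).trans_le ?_⟩
  exact hmono i j (Finset.le_sup (f := fun q : S × S => k q.1 q.2) (Finset.mem_univ (i, j)))

omit [DecidableEq S] in
lemma mulVec_pos_of_pos {P : Matrix S S ℝ} (hP : ∀ i j, 0 < P i j) {u : S → ℝ}
    (hu : ∀ i, 0 ≤ u i) (hu0 : u ≠ 0) (i : S) : 0 < (P *ᵥ u) i := by
  obtain ⟨j, hj⟩ := Function.ne_iff.mp hu0
  exact Finset.sum_pos' (fun l _ => mul_nonneg (hP i l).le (hu l))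
    ⟨j, Finset.mem_univ j, mul_pos (hP i j) ((hu j).lt_of_ne (Ne.symm hj))⟩

/-- Perron–Frobenius for a nonnegative irreducible matrix, by maximizing the Collatz–Wielandt
bound over the simplex. -/
lemma exists_pos_eigenvector_of_nonneg [Nonempty S] {B : Matrix S S ℝ} (hB : ∀ i j, 0 ≤ B i j)
    (hirr : ∀ i j, Relation.ReflTransGen (fun a b => 0 < B a b) i j) :
    ∃ (r : ℝ) (v : S → ℝ), 0 ≤ r ∧ (∀ i, 0 < v i) ∧ B *ᵥ v = r • v := by
  obtain ⟨k, hk⟩ := exists_one_add_pow_pos hB hirr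
  set P := (1 + B) ^ k with hP
  have hcomm : Commute P B := ((Commute.one_left B).add_left (Commute.refl B)).pow_left k
  -- Summing `r u ≤ B u` over the coordinates of a point of the simplex bounds `r` by the sum of all
  -- entries; this makes `K` below compact.
  set R := ∑ i, ∑ j, B i j with hR
  have hbound : ∀ (r : ℝ) (u : S → ℝ), u ∈ stdSimplex ℝ S → (∀ i, r * u i ≤ (B *ᵥ u) i) →
      r ≤ R := by
    intro r u hu h
    calc r = ∑ i, r * u i := by rw [← Finset.mul_sum, hu.2, mul_one]
      _ ≤ ∑ i, (B *ᵥ u) i := Finset.sum_le_sum fun i _ => h i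
      _ ≤ R := by
        refine Finset.sum_le_sum fun i _ => Finset.sum_le_sum fun j _ => ?_
        refine mul_le_of_le_one_right (hB i j) ?_
        rw [← hu.2]
        exact Finset.single_le_sum (fun l _ => hu.1 l) (Finset.mem_univ j)
  set K : Set (ℝ × (S → ℝ)) :=
    (Set.Icc 0 R ×ˢ stdSimplex ℝ S) ∩ {q | ∀ i, q.1 * q.2 i ≤ (B *ᵥ q.2) i} with hK
  have hKc : IsCompact K := by
    refine (isCompact_Icc.prod (isCompact_stdSimplex ℝ S)).inter_right ?_
    rw [Set.ofPred_forall]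
    refine isClosed_iInter fun i => isClosed_le (by fun_prop) ?_
    exact (continuous_apply i).comp (continuous_const.matrix_mulVec continuous_snd)
  have hKn : K.Nonempty := by
    obtain ⟨i₀⟩ := ‹Nonempty S›
    refine ⟨(0, Pi.single i₀ 1), ⟨⟨⟨le_rfl, ?_⟩, single_mem_stdSimplex ℝ i₀⟩, fun i => ?_⟩⟩
    · exact Finset.sum_nonneg fun i _ => Finset.sum_nonneg fun j _ => hB i j
    · simpa using hB i i₀
  obtain ⟨⟨r, u⟩, ⟨⟨hr, hu⟩, hru⟩, hmax⟩ := hKc.exists_isMaxOn hKn continuous_fst.continuousOn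
  simp only [Set.mem_ofPred_eq] at hr hu hru
  have hu0 : u ≠ 0 := by
    rintro rfl
    simpa using hu.2
  have hPu := mulVec_pos_of_pos hk hu.1 hu0
  -- If `r u ≤ B u` is strict somewhere, applying the positive matrix `P`, which commutes with `B`,
  -- makes it strict everywhere for `P u`. After normalization `P u` admits `r + ε`, contradicting
  -- maximality.
  have heig : B *ᵥ u = r • u := by
    by_contra hne
    have hPw := mulVec_pos_of_pos hk (u := B *ᵥ u - r • u)
      (fun i => sub_nonneg.mpr (hru i)) (sub_ne_zero.mpr hne)
    have hPw' : ∀ i, (P *ᵥ (B *ᵥ u - r • u)) i = (B *ᵥ (P *ᵥ u)) i - r * (P *ᵥ u) i := by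
      intro i
      rw [Matrix.mulVec_sub, Matrix.mulVec_smul, Matrix.mulVec_mulVec, hcomm.eq,
        ← Matrix.mulVec_mulVec]
      rfl
    obtain ⟨i₁, -, hi₁⟩ := Finset.univ.exists_min_image
      (fun i => (P *ᵥ (B *ᵥ u - r • u)) i / (P *ᵥ u) i) Finset.univ_nonempty
    set ε := (P *ᵥ (B *ᵥ u - r • u)) i₁ / (P *ᵥ u) i₁ with hε
    have hεpos : 0 < ε := div_pos (hPw i₁) (hPu i₁)
    set s := ∑ i, (P *ᵥ u) i with hs
    have hspos : 0 < s := Finset.sum_pos (fun i _ => hPu i) Finset.univ_nonempty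
    have hmem : s⁻¹ • (P *ᵥ u) ∈ stdSimplex ℝ S := by
      refine ⟨fun i => mul_nonneg (inv_nonneg.mpr hspos.le) (hPu i).le, ?_⟩
      simp only [Pi.smul_apply, smul_eq_mul, ← Finset.mul_sum, ← hs]
      exact inv_mul_cancel₀ hspos.ne'
    have hfeas : ∀ i, (r + ε) * (s⁻¹ • (P *ᵥ u)) i ≤ (B *ᵥ (s⁻¹ • (P *ᵥ u))) i := by
      intro i
      have h1 := (le_div_iff₀ (hPu i)).mp (hi₁ i (Finset.mem_univ i))
      rw [hPw' i] at h1
      rw [Matrix.mulVec_smul, Pi.smul_apply, Pi.smul_apply, smul_eq_mul, smul_eq_mul,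
        mul_left_comm]
      exact mul_le_mul_of_nonneg_left (by linarith) (inv_nonneg.mpr hspos.le)
    have hle := hmax (a := (r + ε, s⁻¹ • (P *ᵥ u)))
      ⟨⟨⟨by linarith [hr.1], hbound _ _ hmem hfeas⟩, hmem⟩, hfeas⟩
    simp only [Set.mem_ofPred_eq] at hle
    linarith
  refine ⟨r, u, hr.1, fun i => ?_, heig⟩
  -- `P` acts on `u` as a scalar, so the positivity of `P u` passes to `u`.
  have hpow : ∀ n : ℕ, (1 + B) ^ n *ᵥ u = (1 + r) ^ n • u := by
    intro n
    induction n with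
    | zero => simp
    | succ n ih =>
      rw [pow_succ, ← Matrix.mulVec_mulVec, Matrix.add_mulVec, Matrix.one_mulVec, heig,
        show u + r • u = (1 + r) • u by rw [add_smul, one_smul], Matrix.mulVec_smul, ih,
        smul_smul, pow_succ, mul_comm]
  have hi := hPu i
  rw [hP, hpow k] at hi
  exact pos_of_mul_pos_right hi (pow_nonneg (by linarith [hr.1]) k)

/-- A real matrix with nonnegative off-diagonal entries and a positive eigenvector for `r`
has all its complex eigenvalues in the half-plane `re ≤ r`. -/
lemma re_le_of_pos_eigenvector {A : Matrix S S ℝ} (hA : ∀ i j, i ≠ j → 0 ≤ A i j) {r : ℝ}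
    {v : S → ℝ} (hv : ∀ i, 0 < v i) (hAv : A *ᵥ v = r • v) {μ : ℂ}
    (hμ : μ ∈ spectrum ℂ (A.map (algebraMap ℝ ℂ))) : μ.re ≤ r := by
  rw [← Matrix.spectrum_toLin', ← Module.End.hasEigenvalue_iff_mem_spectrum] at hμ
  obtain ⟨w, hw⟩ := hμ.exists_hasEigenvector
  have hw1 : (A.map (algebraMap ℝ ℂ)) *ᵥ w = μ • w := by
    simpa [Matrix.toLin'_apply] using hw.apply_eq_smul
  obtain ⟨j₀, hj₀⟩ := Function.ne_iff.mp hw.2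
  -- Comparing row `i` of the two eigenvector equations at a maximizer of `‖w i‖ / v i` gives `‖μ -
  -- A i i‖ ≤ r - A i i`, a Gershgorin disc after rescaling by `v`.
  obtain ⟨i, -, hi⟩ := Finset.univ.exists_max_image (fun i => ‖w i‖ / v i) ⟨j₀, Finset.mem_univ _⟩
  set m := ‖w i‖ / v i with hm
  have hmw : ∀ j, ‖w j‖ ≤ m * v j := fun j => (div_le_iff₀ (hv j)).mp (hi j (Finset.mem_univ j))
  have hwi : ‖w i‖ = m * v i := by rw [hm, div_mul_cancel₀ _ (hv i).ne']
  have hmpos : 0 < m := by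
    have := hi j₀ (Finset.mem_univ _)
    exact lt_of_lt_of_le (div_pos (norm_pos_iff.mpr hj₀) (hv j₀)) this
  have e1 : (μ - A i i) * w i = ∑ j ∈ Finset.univ.erase i, (A i j : ℂ) * w j := by
    have h := congrFun hw1 i
    simp only [Matrix.mulVec, dotProduct, Matrix.map_apply, Pi.smul_apply, smul_eq_mul] at h
    rw [← Finset.add_sum_erase _ _ (Finset.mem_univ i)] at h
    rw [sub_mul, ← h]
    simp
  have e2 : (r - A i i) * v i = ∑ j ∈ Finset.univ.erase i, A i j * v j := by
    have h := congrFun hAv i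
    simp only [Matrix.mulVec, dotProduct, Pi.smul_apply, smul_eq_mul] at h
    rw [← Finset.add_sum_erase _ _ (Finset.mem_univ i)] at h
    rw [sub_mul, ← h]
    ring
  have h3 : ‖μ - A i i‖ * (m * v i) ≤ (r - A i i) * (m * v i) := by
    rw [← hwi, ← norm_mul, e1, hwi, mul_left_comm, e2, Finset.mul_sum]
    refine (norm_sum_le _ _).trans (Finset.sum_le_sum fun j hj => ?_)
    have hij := hA i j (Finset.ne_of_mem_erase hj).symm
    rw [norm_mul, Complex.norm_real, Real.norm_of_nonneg hij, mul_left_comm]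
    exact mul_le_mul_of_nonneg_left (hmw j) hij
  have h4 := le_of_mul_le_mul_right h3 (mul_pos hmpos (hv i))
  have h5 := (Complex.re_le_norm (μ - A i i)).trans h4
  simp only [Complex.sub_re, Complex.ofReal_re] at h5
  linarith

lemma mem_spectrum_map_of_eigenvector {A : Matrix S S ℝ} {r : ℝ} {v : S → ℝ} (hv : v ≠ 0)
    (hAv : A *ᵥ v = r • v) : (r : ℂ) ∈ spectrum ℂ (A.map (algebraMap ℝ ℂ)) := by
  rw [← Matrix.spectrum_toLin', ← Module.End.hasEigenvalue_iff_mem_spectrum]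
  refine Module.End.hasEigenvalue_of_hasEigenvector (x := fun i => (v i : ℂ)) ⟨?_, ?_⟩
  · rw [Module.End.mem_eigenspace_iff, Matrix.toLin'_apply]
    ext i
    have h := congrFun hAv i
    simp only [Matrix.mulVec, dotProduct, Matrix.map_apply, Pi.smul_apply, smul_eq_mul] at h ⊢
    simp only [Complex.coe_algebraMap]
    exact_mod_cast h
  · intro h
    exact hv (funext fun i => by simpa using congrFun h i)

lemma exists_pos_eigenvector [Nonempty S] {D : Matrix S S ℝ} (hD : IsRateMatrix D)
    (hirr : IsIrreducibleRate D) (U : S → ℝ) :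
    ∃ (r : ℝ) (v : S → ℝ), (∀ i, 0 < v i) ∧ (D + Matrix.diagonal U) *ᵥ v = r • v := by
  have hdiag : ∀ i, D i i ≤ 0 := by
    intro i
    have h := hD.row_sum i
    rw [← Finset.add_sum_erase _ _ (Finset.mem_univ i)] at h
    have := Finset.sum_nonneg fun j (hj : j ∈ Finset.univ.erase i) =>
      hD.off_diag_nonneg i j (Finset.ne_of_mem_erase hj).symm
    linarith
  -- Adding `c` to the diagonal makes the matrix nonnegative and shifts the eigenvalue by `c`.
  -- Irreducibility survives: positive entries of `D` lie off the diagonal, where nothing changes.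
  set c := ∑ i, |D i i + U i| with hc
  obtain ⟨r, v, -, hv, hBv⟩ := exists_pos_eigenvector_of_nonneg
    (B := D + Matrix.diagonal U + c • (1 : Matrix S S ℝ)) (fun i j => by
      rcases eq_or_ne i j with rfl | hij
      · have : |D i i + U i| ≤ c :=
          Finset.single_le_sum (f := fun i => |D i i + U i|) (fun _ _ => abs_nonneg _)
            (Finset.mem_univ i)
        simp only [Matrix.add_apply, Matrix.diagonal_apply_eq, Matrix.smul_apply,
          Matrix.one_apply_eq, smul_eq_mul, mul_one]
        linarith [neg_abs_le (D i i + U i)]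
      · simpa [hij] using hD.off_diag_nonneg i j hij)
    (fun i j => by
      refine Relation.ReflTransGen.mono (fun a b hab => ?_) i j (hirr i j)
      have hne : a ≠ b := by
        rintro rfl
        exact absurd hab (hdiag a).not_gt
      simpa [hne] using hab)
  refine ⟨r - c, v, hv, ?_⟩
  rw [Matrix.add_mulVec, Matrix.smul_mulVec, Matrix.one_mulVec] at hBv
  rw [sub_smul, ← hBv, add_sub_cancel_right]

lemma maxRealPart_eq_of_pos_eigenvector [Nonempty S] {A : Matrix S S ℝ}
    (hA : ∀ i j, i ≠ j → 0 ≤ A i j) {r : ℝ}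
    {v : S → ℝ} (hv : ∀ i, 0 < v i) (hAv : A *ᵥ v = r • v) : maxRealPart A = r := by
  refine IsGreatest.csSup_eq ⟨⟨r, mem_spectrum_map_of_eigenvector ?_ hAv, Complex.ofReal_re r⟩, ?_⟩
  · rintro rfl
    exact lt_irrefl _ (hv (Classical.arbitrary S))
  · rintro _ ⟨μ, hμ, rfl⟩
    exact re_le_of_pos_eigenvector hA hv hAv hμ

end PerronFrobenius

/-! ### The Lie–Trotter formula in a Banach algebra -/

section LieTrotter

variable {A : Type*} [NormedRing A] [NormOneClass A] [NormedAlgebra ℝ A] [CompleteSpace A]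

lemma norm_normedSpaceExp_le (a : A) : ‖NormedSpace.exp a‖ ≤ Real.exp ‖a‖ := by
  have h := NormedSpace.exp_series_hasSum_exp' (𝕂 := ℝ) ‖a‖
  rw [← Real.exp_eq_exp_ℝ] at h
  rw [← (NormedSpace.exp_series_hasSum_exp' (𝕂 := ℝ) a).tsum_eq]
  refine tsum_of_norm_bounded h fun n => ?_
  rw [norm_smul, Real.norm_of_nonneg (by positivity), smul_eq_mul]
  exact mul_le_mul_of_nonneg_left (norm_pow_le a n) (by positivity)

omit [CompleteSpace A] [NormedAlgebra ℝ A] in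
lemma norm_pow_sub_pow_le {a b : A} {M : ℝ} (hM : 1 ≤ M) (ha : ‖a‖ ≤ M) (hb : ‖b‖ ≤ M) (n : ℕ) :
    ‖a ^ n - b ^ n‖ ≤ n * ‖a - b‖ * M ^ n := by
  have hM0 : 0 ≤ M := zero_le_one.trans hM
  induction n with
  | zero => simp
  | succ n ih =>
    have e : a ^ (n + 1) - b ^ (n + 1) = a ^ n * (a - b) + (a ^ n - b ^ n) * b := by
      simp only [pow_succ]; noncomm_ring
    rw [e]
    have h1 : ‖a ^ n * (a - b)‖ ≤ M ^ (n + 1) * ‖a - b‖ :=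
      (norm_mul_le _ _).trans (mul_le_mul_of_nonneg_right
        (((norm_pow_le a n).trans (pow_le_pow_left₀ (norm_nonneg _) ha n)).trans
          (pow_le_pow_right₀ hM n.le_succ)) (norm_nonneg _))
    have h2 : ‖(a ^ n - b ^ n) * b‖ ≤ n * ‖a - b‖ * M ^ n * M :=
      (norm_mul_le _ _).trans (mul_le_mul ih hb (norm_nonneg _) (by positivity))
    refine (norm_add_le _ _).trans ((add_le_add h1 h2).trans (le_of_eq ?_))
    push_cast
    ring

/-- The Lie–Trotter product formula. -/
lemma tendsto_exp_mul_exp_pow (a b : A) :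
    Tendsto (fun N : ℕ => (NormedSpace.exp ((N : ℝ)⁻¹ • a) * NormedSpace.exp ((N : ℝ)⁻¹ • b)) ^ N)
      atTop (𝓝 (NormedSpace.exp (a + b))) := by
  -- The one-step error `f` vanishes at `0` together with its derivative, so `N` errors at step
  -- `1/N` add up to `o(1)`.
  set f : ℝ → A := fun h =>
    NormedSpace.exp (h • a) * NormedSpace.exp (h • b) - NormedSpace.exp (h • (a + b)) with hf
  have hder : HasDerivAt f 0 0 := by
    have h := ((hasDerivAt_exp_smul_const a (0 : ℝ)).mul (hasDerivAt_exp_smul_const b (0 : ℝ))).sub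
      (hasDerivAt_exp_smul_const (a + b) (0 : ℝ))
    refine h.congr_deriv ?_
    simp
  have hinv : Tendsto (fun N : ℕ => (N : ℝ)⁻¹) atTop (𝓝[≠] 0) :=
    tendsto_nhdsWithin_iff.mpr ⟨tendsto_inv_atTop_nhds_zero_nat, by
      filter_upwards [eventually_ne_atTop 0] with N hN
      simpa using hN⟩
  have hslope : Tendsto (fun N : ℕ => (N : ℝ) * ‖f (N : ℝ)⁻¹‖) atTop (𝓝 0) := by
    have h := (hder.tendsto_slope_zero.comp hinv).norm
    simpa [hf, Function.comp_def, norm_smul] using h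
  rw [tendsto_iff_norm_sub_tendsto_zero]
  have hlim := hslope.mul_const (Real.exp (‖a‖ + ‖b‖))
  rw [zero_mul] at hlim
  refine squeeze_zero' (.of_forall fun _ => norm_nonneg _) ?_ hlim
  filter_upwards [eventually_ne_atTop 0] with N hN
  have hN' : (N : ℝ) ≠ 0 := Nat.cast_ne_zero.mpr hN
  let := NormedAlgebra.restrictScalars ℚ ℝ A
  have hpow : NormedSpace.exp (a + b) = NormedSpace.exp ((N : ℝ)⁻¹ • (a + b)) ^ N := by
    rw [← NormedSpace.exp_nsmul (𝔸 := A), ← Nat.cast_smul_eq_nsmul ℝ, smul_smul,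
      mul_inv_cancel₀ hN', one_smul]
  -- `M` bounds the norm of both one-step factors, and `M ^ N` does not depend on `N`.
  set M := Real.exp ((N : ℝ)⁻¹ * (‖a‖ + ‖b‖)) with hM
  have hMN : M ^ N = Real.exp (‖a‖ + ‖b‖) := by
    rw [hM, ← Real.exp_nat_mul, ← mul_assoc, mul_inv_cancel₀ hN', one_mul]
  have hnorm : ∀ c : A, ‖(N : ℝ)⁻¹ • c‖ = (N : ℝ)⁻¹ * ‖c‖ := fun c => by
    rw [norm_smul, Real.norm_of_nonneg (by positivity)]
  rw [hpow, ← hMN]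
  refine norm_pow_sub_pow_le (Real.one_le_exp (by positivity)) ?_ ?_ N
  · refine (norm_mul_le _ _).trans ((mul_le_mul (norm_normedSpaceExp_le _)
      (norm_normedSpaceExp_le _) (norm_nonneg _) (Real.exp_nonneg _)).trans (le_of_eq ?_))
    rw [← Real.exp_add, hnorm, hnorm, ← mul_add]
  · refine (norm_normedSpaceExp_le _).trans (Real.exp_le_exp.mpr ?_)
    rw [hnorm]
    exact mul_le_mul_of_nonneg_left (norm_add_le a b) (by positivity)

end LieTrotter

/-! ### Exponentials of real matrices: limits, positivity, eigenvectors -/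

section MatrixExp

variable {S : Type*} [Fintype S] [DecidableEq S]

open scoped Matrix.Norms.Operator in
lemma Matrix.tendsto_exp_mul_exp_pow (A B : Matrix S S ℝ) :
    Tendsto (fun N : ℕ => (NormedSpace.exp ((N : ℝ)⁻¹ • A) * NormedSpace.exp ((N : ℝ)⁻¹ • B)) ^ N)
      atTop (𝓝 (NormedSpace.exp (A + B))) := by
  -- On an empty index set `1 = 0`, so `NormOneClass` fails and the case is separate.
  cases isEmpty_or_nonempty S
  · simp only [Subsingleton.elim _ (0 : Matrix S S ℝ)]
    exact tendsto_const_nhds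
  · exact _root_.tendsto_exp_mul_exp_pow A B

open scoped Matrix.Norms.Operator in
lemma Matrix.hasSum_exp (A : Matrix S S ℝ) :
    HasSum (fun n : ℕ => ((n.factorial : ℝ)⁻¹) • A ^ n) (NormedSpace.exp A) :=
  NormedSpace.exp_series_hasSum_exp' (𝕂 := ℝ) A

lemma Matrix.exp_apply_nonneg {B : Matrix S S ℝ} (hB : ∀ i j, 0 ≤ B i j) (i j : S) :
    0 ≤ NormedSpace.exp B i j := by
  have hpow : ∀ (k : ℕ) i j, 0 ≤ (B ^ k) i j := by
    intro k
    induction k with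
    | zero => intro i j; rw [pow_zero, Matrix.one_apply]; split_ifs <;> norm_num
    | succ k ih =>
      intro i j
      rw [pow_succ, Matrix.mul_apply]
      exact Finset.sum_nonneg fun l _ => mul_nonneg (ih i l) (hB l j)
  have h := Pi.hasSum.mp (Pi.hasSum.mp (Matrix.hasSum_exp B) i) j
  exact h.nonneg fun n => mul_nonneg (by positivity) (hpow n i j)

lemma Matrix.exp_smul_one (c : ℝ) :
    NormedSpace.exp (c • (1 : Matrix S S ℝ)) = Real.exp c • (1 : Matrix S S ℝ) := by
  rw [Matrix.smul_one_eq_diagonal, Matrix.exp_diagonal, Matrix.smul_one_eq_diagonal]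
  congr 1
  ext i
  rw [Pi.coe_exp, Real.exp_eq_exp_ℝ]

lemma Matrix.exp_add_smul_one (A : Matrix S S ℝ) (c : ℝ) :
    NormedSpace.exp (A + c • (1 : Matrix S S ℝ)) = Real.exp c • NormedSpace.exp A := by
  rw [Matrix.exp_add_of_commute _ _ ((Commute.one_right A).smul_right c), Matrix.exp_smul_one,
    mul_smul_comm, mul_one]

/-- Adding `c • 1` makes all entries nonnegative and only multiplies the exponential by `e^c`. -/
lemma Matrix.exp_apply_nonneg_of_offDiag {A : Matrix S S ℝ} (hA : ∀ i j, i ≠ j → 0 ≤ A i j)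
    (i j : S) : 0 ≤ NormedSpace.exp A i j := by
  set c := ∑ i, |A i i| with hc
  have h := Matrix.exp_apply_nonneg (B := A + c • (1 : Matrix S S ℝ)) (fun i j => by
    rcases eq_or_ne i j with rfl | hij
    · have : |A i i| ≤ c := Finset.single_le_sum (f := fun i => |A i i|)
        (fun _ _ => abs_nonneg _) (Finset.mem_univ i)
      simp only [Matrix.add_apply, Matrix.smul_apply, Matrix.one_apply_eq, smul_eq_mul, mul_one]
      linarith [neg_abs_le (A i i)]
    · simpa [hij] using hA i j hij) i j
  rw [Matrix.exp_add_smul_one] at h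
  exact nonneg_of_mul_nonneg_right h (Real.exp_pos c)

lemma Matrix.exp_mulVec_of_eigenvector {A : Matrix S S ℝ} {r : ℝ} {v : S → ℝ}
    (h : A *ᵥ v = r • v) : NormedSpace.exp A *ᵥ v = Real.exp r • v := by
  have hpow : ∀ n : ℕ, A ^ n *ᵥ v = r ^ n • v := by
    intro n
    induction n with
    | zero => simp
    | succ n ih =>
      rw [pow_succ, ← Matrix.mulVec_mulVec, h, Matrix.mulVec_smul, ih, smul_smul, pow_succ,
        mul_comm]
  have h1 : HasSum (fun n : ℕ => ((n.factorial : ℝ)⁻¹ • A ^ n) *ᵥ v) (NormedSpace.exp A *ᵥ v) :=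
    (Matrix.hasSum_exp A).map (⟨⟨fun B : Matrix S S ℝ => B *ᵥ v, Matrix.zero_mulVec v⟩,
      fun B C => Matrix.add_mulVec B C v⟩ : Matrix S S ℝ →+ (S → ℝ))
      (continuous_id.matrix_mulVec continuous_const)
  have h2 : HasSum (fun n : ℕ => ((n.factorial : ℝ)⁻¹ • A ^ n) *ᵥ v) (Real.exp r • v) := by
    have h3 := (NormedSpace.exp_series_hasSum_exp' (𝕂 := ℝ) r).smul_const v
    rw [← Real.exp_eq_exp_ℝ] at h3
    refine h3.congr_fun ?_
    intro n
    rw [Matrix.smul_mulVec, hpow, smul_smul, smul_eq_mul]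
  exact h1.unique h2

end MatrixExp

/-! ### The twisted generator and its semigroup -/

section Twisted

variable {S : Type*} [Fintype S] [DecidableEq S] {D : Matrix S S ℝ} {U : S → ℝ} {Λ : ℝ} {v : S → ℝ}

lemma Matrix.inv_diagonal_of_pos (hv : ∀ y, 0 < v y) :
    (Matrix.diagonal v)⁻¹ = Matrix.diagonal v⁻¹ := by
  refine Matrix.inv_eq_right_inv ?_
  rw [Matrix.diagonal_mul_diagonal, ← Matrix.diagonal_one]
  congr 1
  ext y
  exact mul_inv_cancel₀ (hv y).ne'

lemma twistedGenerator_apply (hv : ∀ y, 0 < v y) (i j : S) : twistedGenerator D U Λ v i j =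
    (v i)⁻¹ * (D + Matrix.diagonal U - Λ • (1 : Matrix S S ℝ)) i j * v j := by
  rw [twistedGenerator, Matrix.mul_diagonal, Matrix.inv_diagonal_of_pos hv, Matrix.diagonal_mul,
    Pi.inv_apply]

lemma isRateMatrix_twistedGenerator (hD : ∀ i j, i ≠ j → 0 ≤ D i j) (hv : ∀ y, 0 < v y)
    (hDv : (D + Matrix.diagonal U) *ᵥ v = Λ • v) : IsRateMatrix (twistedGenerator D U Λ v) where
  off_diag_nonneg i j hij := by
    rw [twistedGenerator_apply hv]
    refine mul_nonneg (mul_nonneg (inv_nonneg.mpr (hv i).le) ?_) (hv j).le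
    simpa [hij] using hD i j hij
  row_sum i := by
    simp only [twistedGenerator_apply hv, mul_assoc, ← Finset.mul_sum]
    have h : (D + Matrix.diagonal U - Λ • (1 : Matrix S S ℝ)) *ᵥ v = 0 := by
      rw [Matrix.sub_mulVec, hDv, Matrix.smul_mulVec, Matrix.one_mulVec, sub_self]
    have := congrFun h i
    simp only [Matrix.mulVec, dotProduct, Pi.zero_apply] at this
    rw [this, mul_zero]

/-- Conjugation passes through the exponential, and the multiple of the identity becomes a scalar
factor: this is the Doob transform of the Feynman–Kac kernel. -/
lemma exp_smul_twistedGenerator_apply (hv : ∀ y, 0 < v y) (τ : ℝ) (i j : S) :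
    NormedSpace.exp (τ • twistedGenerator D U Λ v) i j =
      (v i)⁻¹ * (Real.exp (-(τ * Λ)) *
        NormedSpace.exp (τ • (D + Matrix.diagonal U)) i j) * v j := by
  have hunit : IsUnit (Matrix.diagonal v) := by
    rw [Matrix.isUnit_diagonal, Pi.isUnit_iff]
    exact fun y => (hv y).ne'.isUnit
  have e : τ • twistedGenerator D U Λ v = (Matrix.diagonal v)⁻¹ *
      (τ • (D + Matrix.diagonal U) + (-(τ * Λ)) • (1 : Matrix S S ℝ)) * Matrix.diagonal v := by
    rw [twistedGenerator, ← Matrix.smul_mul, ← Matrix.mul_smul, smul_sub, smul_smul, neg_smul,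
      sub_eq_add_neg]
  rw [e, Matrix.exp_conj' _ _ hunit, Matrix.exp_add_smul_one, Matrix.mul_diagonal,
    Matrix.inv_diagonal_of_pos hv, Matrix.diagonal_mul, Pi.inv_apply,
    Matrix.smul_apply, smul_eq_mul]

end Twisted

/-! ### Riemann sums of right continuous functions -/

section RiemannSums

/-- The least point of the grid `a + hℤ` that is at least `r`. -/
noncomputable def gridCeil (a h r : ℝ) : ℝ := a + ⌈(r - a) / h⌉ * h

lemma le_gridCeil {a h : ℝ} (hh : 0 < h) (r : ℝ) : r ≤ gridCeil a h r := by
  have := (div_le_iff₀ hh).mp (Int.le_ceil ((r - a) / h))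
  rw [gridCeil]
  linarith

lemma gridCeil_lt {a h : ℝ} (hh : 0 < h) (r : ℝ) : gridCeil a h r < r + h := by
  have h1 := mul_lt_mul_of_pos_right (Int.ceil_lt_add_one ((r - a) / h)) hh
  rw [add_mul, div_mul_cancel₀ _ hh.ne'] at h1
  rw [gridCeil]
  linarith

lemma gridCeil_eq {a h : ℝ} (hh : 0 < h) {j : ℕ} {r : ℝ}
    (hr : r ∈ Set.Ioc (a + j * h) (a + (j + 1 : ℕ) * h)) : gridCeil a h r = a + (j + 1 : ℕ) * h := by
  have : ⌈(r - a) / h⌉ = ((j + 1 : ℕ) : ℤ) := by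
    rw [Int.ceil_eq_iff]
    constructor
    · rw [lt_div_iff₀ hh]
      have := hr.1
      push_cast
      linarith
    · rw [div_le_iff₀ hh]
      have := hr.2
      push_cast at this ⊢
      linarith
  rw [gridCeil, this]
  push_cast
  rfl

lemma tendsto_gridCeil {h : ℕ → ℝ} (hh : ∀ᶠ N in atTop, 0 < h N) (hlim : Tendsto h atTop (𝓝 0))
    (a r : ℝ) : Tendsto (fun N => gridCeil a (h N) r) atTop (𝓝[≥] r) := by
  refine tendsto_nhdsWithin_iff.mpr ⟨?_, by filter_upwards [hh] with N hN using le_gridCeil hN r⟩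
  refine tendsto_of_tendsto_of_tendsto_of_le_of_le' tendsto_const_nhds
    (by simpa using hlim.const_add r) ?_ ?_
  · filter_upwards [hh] with N hN using le_gridCeil hN r
  · filter_upwards [hh] with N hN using (gridCeil_lt hN r).le

/-- The function factors through an integer-valued ceiling, so `φ` may be arbitrary. -/
lemma measurable_comp_gridCeil (φ : ℝ → ℝ) (a h : ℝ) :
    Measurable fun r => φ (gridCeil a h r) := by
  have h1 : Measurable fun r : ℝ => ⌈(r - a) / h⌉ := by fun_prop
  exact (measurable_from_top (f := fun k : ℤ => φ (a + k * h))).comp h1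

lemma measurable_of_right_continuous {φ : ℝ → ℝ} (hφ : ∀ r, Tendsto φ (𝓝[≥] r) (𝓝 (φ r))) :
    Measurable φ := by
  refine measurable_of_tendsto_metrizable
    (fun N : ℕ => measurable_comp_gridCeil φ 0 (1 / ((N : ℝ) + 1))) ?_
  refine tendsto_pi_nhds.mpr fun r => (hφ r).comp ?_
  exact tendsto_gridCeil (.of_forall fun N => by positivity)
    tendsto_one_div_add_atTop_nhds_zero_nat 0 r

lemma intervalIntegrable_of_measurable_of_bounded {φ : ℝ → ℝ} (hφ : Measurable φ) {C : ℝ}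
    (hC : ∀ r, |φ r| ≤ C) (a b : ℝ) : IntervalIntegrable φ volume a b :=
  (intervalIntegrable_const (c := C)).mono_fun hφ.aestronglyMeasurable
    (.of_forall fun r => (hC r).trans (le_abs_self C))

/-- Right Riemann sums of a bounded right continuous function converge to its integral. -/
lemma tendsto_riemannSum {φ : ℝ → ℝ} (hφ : ∀ r, Tendsto φ (𝓝[≥] r) (𝓝 (φ r))) {C : ℝ}
    (hC : ∀ r, |φ r| ≤ C) {a b : ℝ} (hab : a ≤ b) :
    Tendsto (fun N : ℕ => ∑ j ∈ Finset.range N,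
      (b - a) / N * φ (a + (j + 1 : ℕ) * ((b - a) / N))) atTop (𝓝 (∫ r in a..b, φ r)) := by
  rcases hab.eq_or_lt with rfl | hlt
  · simp
  have hpos : ∀ᶠ N : ℕ in atTop, 0 < (b - a) / N := by
    filter_upwards [eventually_gt_atTop 0] with N hN
    exact div_pos (sub_pos.mpr hlt) (Nat.cast_pos.mpr hN)
  have hlim : Tendsto (fun N : ℕ => (b - a) / (N : ℝ)) atTop (𝓝 0) :=
    tendsto_const_div_atTop_nhds_zero_nat (b - a)
  -- The right Riemann sum is the integral of the step function `φ ∘ gridCeil`. Grid points approach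
  -- `r` from the right, so right continuity gives pointwise convergence.
  have hint : Tendsto (fun N : ℕ => ∫ r in a..b, φ (gridCeil a ((b - a) / N) r)) atTop
      (𝓝 (∫ r in a..b, φ r)) := by
    refine intervalIntegral.tendsto_integral_filter_of_dominated_convergence (fun _ => C)
      (.of_forall fun N => (measurable_comp_gridCeil φ _ _).aestronglyMeasurable)
      (.of_forall fun N => .of_forall fun r _ => hC _) intervalIntegrable_const
      (.of_forall fun r _ => ?_)
    exact (hφ r).comp (tendsto_gridCeil hpos hlim a r)
  refine hint.congr' ?_
  filter_upwards [hpos, eventually_gt_atTop 0] with N hN hN0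
  set h := (b - a) / N with hh
  have hb : a + (N : ℝ) * h = b := by
    rw [hh, mul_div_cancel₀ _ (Nat.cast_ne_zero.mpr hN0.ne')]
    ring
  have hsum := intervalIntegral.sum_integral_adjacent_intervals (μ := volume)
    (f := fun r => φ (gridCeil a h r)) (a := fun j : ℕ => a + (j : ℝ) * h) (n := N)
    (fun k _ => intervalIntegrable_of_measurable_of_bounded (measurable_comp_gridCeil φ a h)
      (fun r => hC _) _ _)
  simp only [Nat.cast_zero, zero_mul, add_zero, hb] at hsum
  rw [← hsum]
  refine Finset.sum_congr rfl fun j _ => ?_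
  have hle : a + (j : ℝ) * h ≤ a + ((j + 1 : ℕ) : ℝ) * h := by
    push_cast
    linarith
  rw [intervalIntegral.integral_congr_ae (g := fun _ => φ (a + ((j + 1 : ℕ) : ℝ) * h))
    (.of_forall fun r hr => ?_), intervalIntegral.integral_const]
  · rw [smul_eq_mul]
    congr 1
    push_cast
    ring
  · rw [Set.uIoc_of_le hle] at hr
    simp only [gridCeil_eq hN hr]

end RiemannSums

/-! ### The filtration of the path and its generating cylinders -/

section Past

variable {S : Type*} {T : ℝ≥0}

/-- The sigma-algebra generated by the path up to time `s`. -/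
abbrev pathPast (S : Type*) {T : ℝ≥0} (s : Set.Icc (0 : ℝ) T) : MeasurableSpace (CadlagPath S T) :=
  ⨆ r : Set.Iic s, MeasurableSpace.comap (fun ω : CadlagPath S T => ω r) ⊤

lemma pathPast_mono {s t : Set.Icc (0 : ℝ) T} (h : s ≤ t) : pathPast S s ≤ pathPast S t :=
  iSup_le fun r => le_iSup (fun r : Set.Iic t =>
    MeasurableSpace.comap (fun ω : CadlagPath S T => ω r) ⊤) ⟨r, r.2.trans h⟩

lemma pathPast_le (s : Set.Icc (0 : ℝ) T) : pathPast S s ≤ CadlagPath.instMeasurableSpace :=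
  iSup_le fun r => le_iSup (fun r : Set.Icc (0 : ℝ) T =>
    MeasurableSpace.comap (fun ω : CadlagPath S T => ω r) ⊤) r

lemma pathPast_endTime : pathPast S (endTime T) = CadlagPath.instMeasurableSpace :=
  le_antisymm (pathPast_le _) (iSup_le fun r => le_iSup (fun r : Set.Iic (endTime T) =>
    MeasurableSpace.comap (fun ω : CadlagPath S T => ω r) ⊤) ⟨r, r.2.2⟩)

lemma measurable_comp_eval_pathPast {β : Type*} [MeasurableSpace β] {r s : Set.Icc (0 : ℝ) T}
    (h : r ≤ s) (f : S → β) : Measurable[pathPast S s] fun ω : CadlagPath S T => f (ω r) := by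
  have h1 : @Measurable _ _ (pathPast S s) ⊤ fun ω : CadlagPath S T => ω r :=
    Measurable.of_comap_le (le_iSup (fun r : Set.Iic s =>
      MeasurableSpace.comap (fun ω : CadlagPath S T => ω r) ⊤) ⟨r, h⟩)
  exact (measurable_from_top (f := f)).comp h1

lemma measurable_comp_eval {β : Type*} [MeasurableSpace β] (r : Set.Icc (0 : ℝ) T)
    (f : S → β) : Measurable fun ω : CadlagPath S T => f (ω r) :=
  (measurable_comp_eval_pathPast le_rfl f).mono (pathPast_le r) le_rfl

lemma measurableSet_eval_eq_pathPast {r s : Set.Icc (0 : ℝ) T} (h : r ≤ s) (y : S) :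
    MeasurableSet[pathPast S s] {ω : CadlagPath S T | ω r = y} :=
  (@measurableSet_setOfPred _ (pathPast S s) _).mpr (measurable_comp_eval_pathPast h (· = y))

lemma measurableSet_eval_eq (r : Set.Icc (0 : ℝ) T) (y : S) :
    MeasurableSet {ω : CadlagPath S T | ω r = y} :=
  pathPast_le r _ (measurableSet_eval_eq_pathPast le_rfl y)

/-- The cylinder sets of finitely many times up to `s`, among them the initial time and `s`. -/
def pastCylinders (S : Type*) {T : ℝ≥0} (s : Set.Icc (0 : ℝ) T) : Set (Set (CadlagPath S T)) :=
  {A | ∃ F : Finset (Set.Icc (0 : ℝ) T), startTime T ∈ F ∧ s ∈ F ∧ (∀ r ∈ F, r ≤ s) ∧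
    ∃ ω₀ : CadlagPath S T, A = {ω | ∀ r ∈ F, ω r = ω₀ r}}

/-- Values are prescribed by an actual path, so any path in the intersection of two cylinders labels
that intersection. Requiring the initial time makes `IsMarkovLaw` applicable; requiring `s` makes
the state at time `s` constant on each cylinder. -/
lemma isPiSystem_pastCylinders (s : Set.Icc (0 : ℝ) T) : IsPiSystem (pastCylinders S s) := by
  classical
  rintro _ ⟨F, h0, hs, hF, ω₁, rfl⟩ _ ⟨G, -, -, hG, ω₂, rfl⟩ ⟨ω₀, hω1, hω2⟩
  refine ⟨F ∪ G, Finset.mem_union_left _ h0, Finset.mem_union_left _ hs, fun r hr => ?_, ω₀, ?_⟩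
  · exact (Finset.mem_union.mp hr).elim (hF r) (hG r)
  · ext ω
    constructor
    · rintro ⟨h1, h2⟩ r hr
      rcases Finset.mem_union.mp hr with hr | hr
      · exact (h1 r hr).trans (hω1 r hr).symm
      · exact (h2 r hr).trans (hω2 r hr).symm
    · intro h
      exact ⟨fun r hr => (h r (Finset.mem_union_left _ hr)).trans (hω1 r hr),
        fun r hr => (h r (Finset.mem_union_right _ hr)).trans (hω2 r hr)⟩

lemma startTime_le (s : Set.Icc (0 : ℝ) T) : startTime T ≤ s := s.2.1

lemma le_endTime (s : Set.Icc (0 : ℝ) T) : s ≤ endTime T := s.2.2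

lemma pathPast_eq_generateFrom [Finite S] (s : Set.Icc (0 : ℝ) T) :
    pathPast S s = MeasurableSpace.generateFrom (pastCylinders S s) := by
  classical
  refine le_antisymm (iSup_le fun r => ?_) (MeasurableSpace.generateFrom_le ?_)
  · rintro _ ⟨B, -, rfl⟩
    -- An event about time `r` alone is split by the states at the two compulsory times; the union
    -- is countable because `S` is finite.
    have hu : (fun ω : CadlagPath S T => ω r) ⁻¹' B =
        ⋃ q : S × B × S, {ω | ω (startTime T) = q.1 ∧ ω r = (q.2.1 : S) ∧ ω s = q.2.2} := by
      ext ω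
      simp only [Set.mem_preimage, Set.mem_iUnion, Set.mem_ofPred_eq]
      constructor
      · intro h
        exact ⟨(ω (startTime T), ⟨ω r, h⟩, ω s), rfl, rfl, rfl⟩
      · rintro ⟨q, -, h, -⟩
        rw [h]
        exact q.2.1.2
    rw [hu]
    refine @MeasurableSet.iUnion _ _ (MeasurableSpace.generateFrom (pastCylinders S s)) _ _
      fun q => ?_
    rcases Set.eq_empty_or_nonempty
      {ω : CadlagPath S T | ω (startTime T) = q.1 ∧ ω r = (q.2.1 : S) ∧ ω s = q.2.2} with h | ⟨ω₀, h⟩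
    · rw [h]
      exact @MeasurableSet.empty _ (MeasurableSpace.generateFrom (pastCylinders S s))
    · obtain ⟨h1, h2, h3⟩ := h
      refine MeasurableSpace.measurableSet_generateFrom
        ⟨{startTime T, (r : Set.Icc (0 : ℝ) T), s}, by simp, by simp, ?_, ω₀, ?_⟩
      · intro r' hr'
        simp only [Finset.mem_insert, Finset.mem_singleton] at hr'
        rcases hr' with rfl | rfl | rfl
        · exact startTime_le s
        · exact r.2
        · exact le_rfl
      · ext ω
        simp [h1, h2, h3]
  · rintro _ ⟨F, -, -, hF, ω₀, rfl⟩
    have : {ω : CadlagPath S T | ∀ r ∈ F, ω r = ω₀ r} = ⋂ r ∈ F, {ω | ω r = ω₀ r} := by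
      ext ω
      simp
    rw [this]
    exact MeasurableSet.biInter F.countable_toSet
      fun r hr => measurableSet_eval_eq_pathPast (hF r hr) (ω₀ r)

lemma exists_monotone_enumeration {s : Set.Icc (0 : ℝ) T} {F : Finset (Set.Icc (0 : ℝ) T)}
    (h0 : startTime T ∈ F) (hs : s ∈ F) (hF : ∀ r ∈ F, r ≤ s) :
    ∃ (n : ℕ) (e : Fin (n + 1) → Set.Icc (0 : ℝ) T), Monotone e ∧ e 0 = startTime T ∧
      e (Fin.last n) = s ∧ Set.range e = F := by
  have hcard : F.card = (F.card - 1) + 1 := (Nat.succ_pred_eq_of_pos (Finset.card_pos.mpr ⟨s, hs⟩)).symm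
  refine ⟨F.card - 1, F.orderEmbOfFin hcard, (F.orderEmbOfFin hcard).monotone, ?_, ?_,
    F.range_orderEmbOfFin hcard⟩
  · obtain ⟨i, hi⟩ : startTime T ∈ Set.range (F.orderEmbOfFin hcard) := by
      rw [F.range_orderEmbOfFin hcard]; exact h0
    refine le_antisymm ?_ (startTime_le _)
    rw [← hi]
    exact (F.orderEmbOfFin hcard).monotone (Fin.zero_le i)
  · obtain ⟨i, hi⟩ : s ∈ Set.range (F.orderEmbOfFin hcard) := by
      rw [F.range_orderEmbOfFin hcard]; exact hs
    refine le_antisymm (hF _ (F.orderEmbOfFin_mem hcard _)) ?_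
    conv_lhs => rw [← hi]
    exact (F.orderEmbOfFin hcard).monotone (Fin.le_last i)

end Past

/-! ### Uniqueness of Markov laws and their transitions on cylinders -/

section MarkovLaw

variable {S : Type*} [Fintype S] [DecidableEq S] {T : ℝ≥0} {D : Matrix S S ℝ} {x : S}
  {p : Measure (CadlagPath S T)}

lemma IsMarkovLaw.measure_startTime (hp : IsMarkovLaw D x T p) (y : S) :
    p {ω | ω (startTime T) = y} = if y = x then 1 else 0 := by
  have h := hp 0 (fun _ => startTime T) (fun _ => y) monotone_const rfl
  have e : {ω : CadlagPath S T | ∀ _ : Fin (0 + 1), ω (startTime T) = y} =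
      {ω | ω (startTime T) = y} := by
    ext ω
    simp
  rw [e] at h
  rw [h]
  split_ifs <;> simp

lemma IsMarkovLaw.isProbabilityMeasure (hp : IsMarkovLaw D x T p) : IsProbabilityMeasure p := by
  refine ⟨?_⟩
  have hu : (Set.univ : Set (CadlagPath S T)) = ⋃ y : S, {ω | ω (startTime T) = y} := by
    ext ω
    simp
  rw [hu, measure_iUnion, tsum_fintype]
  · simp [hp.measure_startTime]
  · intro y z hyz
    exact Set.disjoint_left.mpr fun ω h1 h2 => hyz (h1.symm.trans h2)
  · exact measurableSet_eval_eq _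

lemma IsMarkovLaw.ae_startTime_eq (hp : IsMarkovLaw D x T p) :
    ∀ᵐ ω ∂p, ω (startTime T) = x := by
  have := hp.isProbabilityMeasure
  exact (mem_ae_iff_prob_eq_one (measurableSet_eval_eq (startTime T) x)).mpr
    (by rw [hp.measure_startTime, if_pos rfl])

/-- A Markov law is determined by its generator and its initial state. -/
lemma IsMarkovLaw.unique {q : Measure (CadlagPath S T)} (hp : IsMarkovLaw D x T p)
    (hq : IsMarkovLaw D x T q) : p = q := by
  have := hp.isProbabilityMeasure
  have := hq.isProbabilityMeasure
  refine ext_of_generate_finite (pastCylinders S (endTime T))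
    (pathPast_endTime.symm.trans (pathPast_eq_generateFrom _)) (isPiSystem_pastCylinders _) ?_
    (by simp)
  rintro _ ⟨F, h0, hs, hF, ω₀, rfl⟩
  obtain ⟨n, e, he, he0, -, her⟩ := exists_monotone_enumeration h0 hs hF
  have e1 : {ω : CadlagPath S T | ∀ r ∈ F, ω r = ω₀ r} = {ω | ∀ i, ω (e i) = ω₀ (e i)} := by
    ext ω
    simp only [Set.mem_ofPred_eq, ← Finset.mem_coe, ← her, Set.forall_mem_range]
  rw [e1, hp n e (fun i => ω₀ (e i)) he he0, hq n e (fun i => ω₀ (e i)) he he0]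

/-- Appending `t` to the sorted times of `F` adds one transition factor. This is the Markov property
on cylinders. -/
lemma IsMarkovLaw.measure_inter_eval_eq (hD : ∀ i j, i ≠ j → 0 ≤ D i j)
    (hp : IsMarkovLaw D x T p) {s t : Set.Icc (0 : ℝ) T} (hst : s ≤ t)
    {F : Finset (Set.Icc (0 : ℝ) T)}
    (h0 : startTime T ∈ F) (hs : s ∈ F) (hF : ∀ r ∈ F, r ≤ s) (ω₀ : CadlagPath S T) (z : S) :
    p ({ω | ∀ r ∈ F, ω r = ω₀ r} ∩ {ω | ω t = z}) = p {ω | ∀ r ∈ F, ω r = ω₀ r} *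
      ENNReal.ofReal (NormedSpace.exp (((t : ℝ) - s) • D) (ω₀ s) z) := by
  obtain ⟨n, e, he, he0, hes, her⟩ := exists_monotone_enumeration h0 hs hF
  have e1 : {ω : CadlagPath S T | ∀ r ∈ F, ω r = ω₀ r} = {ω | ∀ i, ω (e i) = ω₀ (e i)} := by
    ext ω
    simp only [Set.mem_ofPred_eq, ← Finset.mem_coe, ← her, Set.forall_mem_range]
  have e2 : {ω : CadlagPath S T | ∀ i, ω (e i) = ω₀ (e i)} ∩ {ω | ω t = z} =
      {ω | ∀ i, ω ((Fin.snoc e t : Fin (n + 2) → Set.Icc (0 : ℝ) T) i) =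
        (Fin.snoc (fun i => ω₀ (e i)) z : Fin (n + 2) → S) i} := by
    ext ω
    simp only [Set.mem_inter_iff, Set.mem_ofPred_eq, Fin.forall_fin_succ', Fin.snoc_castSucc,
      Fin.snoc_last]
  have hmono : Monotone (Fin.snoc e t : Fin (n + 2) → Set.Icc (0 : ℝ) T) := by
    intro i j hij
    induction j using Fin.lastCases with
    | last =>
      induction i using Fin.lastCases with
      | last => exact le_rfl
      | cast i =>
        simp only [Fin.snoc_castSucc, Fin.snoc_last]
        refine le_trans ?_ hst
        rw [← hes]
        exact he (Fin.le_last i)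
    | cast j =>
      induction i using Fin.lastCases with
      | last => exact absurd hij (not_le.mpr (Fin.castSucc_lt_last j))
      | cast i =>
        simp only [Fin.snoc_castSucc]
        exact he (Fin.castSucc_le_castSucc_iff.mp hij)
  have hzero : (Fin.snoc e t : Fin (n + 2) → Set.Icc (0 : ℝ) T) 0 = startTime T := by
    rw [← he0, ← Fin.castSucc_zero, Fin.snoc_castSucc]
  rw [e1, e2, hp (n + 1) _ _ hmono hzero, hp n e (fun i => ω₀ (e i)) he he0,
    ← ENNReal.ofReal_mul, Fin.prod_univ_castSucc, ← mul_assoc]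
  · simp only [Fin.snoc_castSucc, Fin.succ_castSucc, Fin.succ_last, Fin.snoc_last, hes]
    rw [← Fin.castSucc_zero, Fin.snoc_castSucc]
  · refine mul_nonneg (by split_ifs <;> norm_num) (Finset.prod_nonneg fun i _ => ?_)
    refine Matrix.exp_apply_nonneg_of_offDiag (fun a b hab => ?_) _ _
    refine mul_nonneg (sub_nonneg.mpr ?_) (hD a b hab)
    exact he (Fin.castSucc_le_succ i)

end MarkovLaw

/-! ### The Markov property for bounded functionals of the past -/

section MarkovProperty

lemma exists_abs_le_of_finite {S : Type*} [Finite S] (f : S → ℝ) : ∃ C, 0 ≤ C ∧ ∀ y, |f y| ≤ C := by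
  obtain ⟨C, hC⟩ := (Set.finite_range fun y => |f y|).bddAbove
  exact ⟨max C 0, le_max_right _ _, fun y => (hC ⟨y, rfl⟩).trans (le_max_left _ _)⟩

lemma MeasureTheory.integrable_of_measurable_of_abs_le {Ω : Type*} [MeasurableSpace Ω]
    {μ : Measure Ω} [IsFiniteMeasure μ] {f : Ω → ℝ} (hf : Measurable f) {C : ℝ}
    (hC : ∀ ω, |f ω| ≤ C) : Integrable f μ :=
  Integrable.of_bound hf.aestronglyMeasurable C (.of_forall hC)

/-- If `g` is `m`-measurable and has the same integrals as `f` over all `m`-measurable sets, then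
`f` and `g` have the same integrals against bounded `m`-measurable functions. -/
lemma MeasureTheory.integral_mul_eq_of_forall_setIntegral_eq {Ω : Type*} {m m₀ : MeasurableSpace Ω}
    {μ : Measure Ω} [IsFiniteMeasure μ] (hm : m ≤ m₀) {f g Φ : Ω → ℝ} (hf : Integrable f μ)
    (hg : Integrable g μ) (hgm : Measurable[m] g)
    (h : ∀ A, MeasurableSet[m] A → ∫ ω in A, g ω ∂μ = ∫ ω in A, f ω ∂μ)
    (hΦ : Measurable[m] Φ) {C : ℝ} (hC : ∀ ω, |Φ ω| ≤ C) :
    ∫ ω, Φ ω * f ω ∂μ = ∫ ω, Φ ω * g ω ∂μ := by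
  -- `g` is a version of the conditional expectation of `f`, from which the `m`-measurable factor
  -- `Φ` can be pulled out.
  have h1 : g =ᵐ[μ] μ[f | m] := ae_eq_condExp_of_forall_setIntegral_eq hm hf
    (fun _ _ _ => hg.integrableOn) (fun A hA _ => h A hA) hgm.stronglyMeasurable.aestronglyMeasurable
  have hΦf : Integrable (Φ * f) μ :=
    hf.bdd_mul (hΦ.mono hm le_rfl).aestronglyMeasurable (.of_forall hC)
  calc ∫ ω, Φ ω * f ω ∂μ = ∫ ω, (μ[Φ * f | m]) ω ∂μ := (integral_condExp hm).symm
    _ = ∫ ω, Φ ω * g ω ∂μ := by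
      refine integral_congr_ae ?_
      filter_upwards [condExp_mul_of_stronglyMeasurable_left hΦ.stronglyMeasurable hΦf hf, h1]
        with ω h2 h3
      rw [h2, h3, Pi.mul_apply]

variable {S : Type*} [Fintype S] [DecidableEq S] {T : ℝ≥0} {D : Matrix S S ℝ} {x : S}
  {p : Measure (CadlagPath S T)}

omit [DecidableEq S] in
lemma integrable_comp_eval [IsFiniteMeasure p] (r : Set.Icc (0 : ℝ) T) (f : S → ℝ) :
    Integrable (fun ω => f (ω r)) p := by
  obtain ⟨C, -, hC⟩ := exists_abs_le_of_finite f
  exact integrable_of_measurable_of_abs_le (measurable_comp_eval r f) fun ω => hC _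

/-- The dependence on `f` is reduced to finitely many coefficients, so limits in `f` can be taken
state by state. -/
lemma integral_mul_comp_eval [IsFiniteMeasure p] {Φ : CadlagPath S T → ℝ} (hΦ : Measurable Φ)
    {C : ℝ} (hC : ∀ ω, |Φ ω| ≤ C) (r : Set.Icc (0 : ℝ) T) (f : S → ℝ) :
    ∫ ω, Φ ω * f (ω r) ∂p = ∑ z, f z * ∫ ω, Φ ω * (if ω r = z then 1 else 0) ∂p := by
  simp only [← integral_const_mul]
  rw [← integral_finsetSum]
  · refine integral_congr_ae (.of_forall fun ω => ?_)
    simp [mul_comm]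
  · intro z _
    refine Integrable.const_mul ?_ _
    exact (integrable_comp_eval r (fun y => if y = z then (1 : ℝ) else 0)).bdd_mul
      hΦ.aestronglyMeasurable (.of_forall hC)

lemma setIntegral_comp_eval [IsFiniteMeasure p] (A : Set (CadlagPath S T))
    (r : Set.Icc (0 : ℝ) T) (f : S → ℝ) :
    ∫ ω in A, f (ω r) ∂p = ∑ z, f z * (p (A ∩ {ω | ω r = z})).toReal := by
  have h := integral_mul_comp_eval (p := p.restrict A) (Φ := fun _ => 1) measurable_const
    (C := 1) (by simp) r f
  simp only [one_mul] at h
  rw [h]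
  refine Finset.sum_congr rfl fun z _ => ?_
  have e : (fun ω : CadlagPath S T => if ω r = z then (1 : ℝ) else 0) =
      Set.indicator {ω | ω r = z} 1 := by
    ext ω
    simp [Set.indicator_apply]
  rw [e, integral_indicator_one (measurableSet_eval_eq r z), measureReal_def,
    Measure.restrict_apply (measurableSet_eval_eq r z), Set.inter_comm]

lemma IsMarkovLaw.setIntegral_eq (hD : ∀ i j, i ≠ j → 0 ≤ D i j) (hp : IsMarkovLaw D x T p)
    {s t : Set.Icc (0 : ℝ) T} (hst : s ≤ t) (f : S → ℝ) (A : Set (CadlagPath S T))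
    (hA : MeasurableSet[pathPast S s] A) :
    ∫ ω in A, (NormedSpace.exp (((t : ℝ) - s) • D) *ᵥ f) (ω s) ∂p = ∫ ω in A, f (ω t) ∂p := by
  have := hp.isProbabilityMeasure
  have hbasic : ∀ A ∈ pastCylinders S s,
      ∫ ω in A, (NormedSpace.exp (((t : ℝ) - s) • D) *ᵥ f) (ω s) ∂p = ∫ ω in A, f (ω t) ∂p := by
    rintro _ ⟨F, h0, hs, hF, ω₀, rfl⟩
    have hA : MeasurableSet {ω : CadlagPath S T | ∀ r ∈ F, ω r = ω₀ r} := by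
      refine pathPast_le s _ ?_
      rw [pathPast_eq_generateFrom]
      exact MeasurableSpace.measurableSet_generateFrom ⟨F, h0, hs, hF, ω₀, rfl⟩
    rw [setIntegral_comp_eval _ t f]
    simp only [hp.measure_inter_eval_eq hD hst h0 hs hF ω₀]
    have hc : Set.EqOn (fun ω : CadlagPath S T => (NormedSpace.exp (((t : ℝ) - s) • D) *ᵥ f) (ω s))
        (fun _ => (NormedSpace.exp (((t : ℝ) - s) • D) *ᵥ f) (ω₀ s))
        {ω : CadlagPath S T | ∀ r ∈ F, ω r = ω₀ r} := fun ω hω => by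
      simp only [hω s hs]
    rw [setIntegral_congr_fun hA hc, setIntegral_const, smul_eq_mul, Matrix.mulVec, dotProduct,
      Finset.mul_sum, measureReal_def]
    refine Finset.sum_congr rfl fun z _ => ?_
    rw [ENNReal.toReal_mul, ENNReal.toReal_ofReal]
    · ring
    · exact Matrix.exp_apply_nonneg_of_offDiag (fun a b hab =>
        mul_nonneg (sub_nonneg.mpr hst) (hD a b hab)) _ _
  have hint := integrable_comp_eval (p := p) t f
  have hint' := integrable_comp_eval (p := p) s (NormedSpace.exp (((t : ℝ) - s) • D) *ᵥ f)
  -- Complements in the π-λ induction need the identity on the whole space, which is a finite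
  -- disjoint union of cylinders at the times `0` and `s`.
  have huniv : ∫ ω, (NormedSpace.exp (((t : ℝ) - s) • D) *ᵥ f) (ω s) ∂p = ∫ ω, f (ω t) ∂p := by
    have hu : (Set.univ : Set (CadlagPath S T)) =
        ⋃ q : S × S, {ω | ω (startTime T) = q.1} ∩ {ω | ω s = q.2} := by
      ext ω
      simp
    have hms : ∀ q : S × S,
        MeasurableSet ({ω : CadlagPath S T | ω (startTime T) = q.1} ∩ {ω | ω s = q.2}) := fun q =>
      (measurableSet_eval_eq _ _).inter (measurableSet_eval_eq _ _)
    have hd : Pairwise (Function.onFun Disjoint fun q : S × S =>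
        {ω : CadlagPath S T | ω (startTime T) = q.1} ∩ {ω | ω s = q.2}) := fun q q' hqq =>
      Set.disjoint_left.mpr fun ω h1 h2 =>
        hqq (Prod.ext (h1.1.symm.trans h2.1) (h1.2.symm.trans h2.2))
    rw [← setIntegral_univ, hu, integral_iUnion hms hd hint'.integrableOn, ← setIntegral_univ, hu,
      integral_iUnion hms hd hint.integrableOn]
    refine tsum_congr fun q => ?_
    rcases Set.eq_empty_or_nonempty
      ({ω : CadlagPath S T | ω (startTime T) = q.1} ∩ {ω | ω s = q.2}) with h | ⟨ω₀, h1, h2⟩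
    · simp [h]
    · refine hbasic _ ⟨{startTime T, s}, by simp, by simp, ?_, ω₀, ?_⟩
      · intro r hr
        simp only [Finset.mem_insert, Finset.mem_singleton] at hr
        rcases hr with rfl | rfl
        · exact startTime_le s
        · exact le_rfl
      · rw [← h1, ← h2]
        ext ω
        simp
  refine MeasurableSpace.induction_on_inter
    (C := fun A _ => ∫ ω in A, (NormedSpace.exp (((t : ℝ) - s) • D) *ᵥ f) (ω s) ∂p =
      ∫ ω in A, f (ω t) ∂p)
    (pathPast_eq_generateFrom s) (isPiSystem_pastCylinders s) (by simp) hbasic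
    (fun A hA ih => ?_) (fun A hdisj hA ih => ?_) A hA
  · have hA' := pathPast_le s A hA
    have h1 := integral_add_compl hA' hint
    have h2 := integral_add_compl hA' hint'
    linarith
  · rw [integral_iUnion (fun i => pathPast_le s _ (hA i)) hdisj hint.integrableOn,
      integral_iUnion (fun i => pathPast_le s _ (hA i)) hdisj hint'.integrableOn]
    exact tsum_congr ih

/-- The Markov property. -/
lemma IsMarkovLaw.integral_mul_comp_eval (hD : ∀ i j, i ≠ j → 0 ≤ D i j)
    (hp : IsMarkovLaw D x T p) {s t : Set.Icc (0 : ℝ) T} (hst : s ≤ t) (f : S → ℝ)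
    {Φ : CadlagPath S T → ℝ} (hΦ : Measurable[pathPast S s] Φ) {C : ℝ} (hC : ∀ ω, |Φ ω| ≤ C) :
    ∫ ω, Φ ω * f (ω t) ∂p =
      ∫ ω, Φ ω * (NormedSpace.exp (((t : ℝ) - s) • D) *ᵥ f) (ω s) ∂p := by
  have := hp.isProbabilityMeasure
  exact integral_mul_eq_of_forall_setIntegral_eq (pathPast_le s) (integrable_comp_eval t f)
    (integrable_comp_eval s _) (measurable_comp_eval_pathPast le_rfl _)
    (hp.setIntegral_eq hD hst f) hΦ hC

end MarkovProperty

/-! ### The accumulated reward: regularity and measurability -/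

section RunningReward

variable {S : Type*} {T : ℝ≥0}

/-- The position at the point of `[0, T]` closest to `r`. -/
noncomputable def CadlagPath.at (ω : CadlagPath S T) (r : ℝ) : S := ω (Set.projIcc 0 (T : ℝ) T.coe_nonneg r)

/-- The reward `∫ U(X_r) dr` collected between the times `a` and `b`. -/
noncomputable def reward (U : S → ℝ) (a b : ℝ) (ω : CadlagPath S T) : ℝ :=
  ∫ r in a..b, U (ω.at r)

lemma CadlagPath.at_coe (ω : CadlagPath S T) (r : Set.Icc (0 : ℝ) T) : ω.at r = ω r := by
  rw [CadlagPath.at, Set.projIcc_val]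

/-- The projection to `[0, T]` is continuous and monotone, so it sends right neighbourhoods to right
neighbourhoods, and the path extended to `ℝ` stays right continuous. -/
lemma tendsto_comp_at (U : S → ℝ) (ω : CadlagPath S T) (r : ℝ) :
    Tendsto (fun r => U (ω.at r)) (𝓝[≥] r) (𝓝 (U (ω.at r))) := by
  have h1 : Tendsto (Set.projIcc 0 (T : ℝ) T.coe_nonneg) (𝓝[≥] r)
      (𝓝[≥] (Set.projIcc 0 (T : ℝ) T.coe_nonneg r)) :=
    continuous_projIcc.continuousWithinAt.tendsto_nhdsWithin
      fun r' hr' => Set.monotone_projIcc T.coe_nonneg hr'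
  have h2 := h1.eventually (ω.right_cont _)
  refine tendsto_const_nhds.congr' ?_
  filter_upwards [h2] with r' hr'
  rw [CadlagPath.at, CadlagPath.at, hr']

lemma intervalIntegrable_comp_at [Finite S] (U : S → ℝ) (ω : CadlagPath S T) (a b : ℝ) :
    IntervalIntegrable (fun r => U (ω.at r)) volume a b := by
  obtain ⟨C, -, hC⟩ := exists_abs_le_of_finite U
  exact intervalIntegrable_of_measurable_of_bounded
    (measurable_of_right_continuous (tendsto_comp_at U ω)) (fun r => hC _) a b

lemma reward_add [Finite S] (U : S → ℝ) (a b c : ℝ) (ω : CadlagPath S T) :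
    reward U a b ω + reward U b c ω = reward U a c ω :=
  intervalIntegral.integral_add_adjacent_intervals (intervalIntegrable_comp_at U ω a b)
    (intervalIntegrable_comp_at U ω b c)

lemma abs_reward_le {U : S → ℝ} {C : ℝ} (hC : ∀ y, |U y| ≤ C) (a b : ℝ) (ω : CadlagPath S T) :
    |reward U a b ω| ≤ C * |b - a| := by
  rw [reward, ← Real.norm_eq_abs]
  exact intervalIntegral.norm_integral_le_of_norm_le_const fun _ _ => hC _

lemma projIcc_le_of_le {r : ℝ} {b : Set.Icc (0 : ℝ) T} (h : r ≤ b) :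
    Set.projIcc 0 (T : ℝ) T.coe_nonneg r ≤ b := by
  rw [← Set.projIcc_val T.coe_nonneg b]
  exact Set.monotone_projIcc T.coe_nonneg h

lemma measurable_riemannSum_pathPast (U : S → ℝ) {a h : ℝ} {b : Set.Icc (0 : ℝ) T} (hh : 0 ≤ h)
    {N : ℕ} (hN : a + N * h ≤ b) : Measurable[pathPast S b] fun ω : CadlagPath S T =>
      ∑ j ∈ Finset.range N, h * U (ω.at (a + (j + 1 : ℕ) * h)) := by
  refine Finset.measurable_fun_sum _ fun j hj => ?_
  refine (measurable_comp_eval_pathPast (projIcc_le_of_le ?_) U).const_mul h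
  have h1 : ((j + 1 : ℕ) : ℝ) ≤ N := Nat.cast_le.mpr (Finset.mem_range.mp hj)
  nlinarith [mul_le_mul_of_nonneg_right h1 hh]

/-- The reward is a limit of Riemann sums that sample the path only up to time `b`. -/
lemma measurable_reward_pathPast [Finite S] (U : S → ℝ) {a : ℝ} {b : Set.Icc (0 : ℝ) T}
    (hab : a ≤ b) : Measurable[pathPast S b] (reward U a b : CadlagPath S T → ℝ) := by
  obtain ⟨C, -, hC⟩ := exists_abs_le_of_finite U
  refine @measurable_of_tendsto_metrizable _ _ (pathPast S b) _ _ _ _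
    (fun (N : ℕ) (ω : CadlagPath S T) => ∑ j ∈ Finset.range N,
      (b - a) / N * U (ω.at (a + (j + 1 : ℕ) * ((b - a) / N)))) _ (fun N => ?_)
    (tendsto_pi_nhds.mpr fun ω => tendsto_riemannSum (tendsto_comp_at U ω) (fun r => hC _) hab)
  refine measurable_riemannSum_pathPast U (div_nonneg (sub_nonneg.mpr hab) N.cast_nonneg) ?_
  rcases eq_or_ne N 0 with rfl | hN
  · simpa using hab
  · rw [mul_div_cancel₀ _ (Nat.cast_ne_zero.mpr hN)]
    linarith

lemma measurable_reward [Finite S] (U : S → ℝ) {a : ℝ} {b : Set.Icc (0 : ℝ) T}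
    (hab : a ≤ b) : Measurable (reward U a b : CadlagPath S T → ℝ) :=
  (measurable_reward_pathPast U hab).mono (pathPast_le b) le_rfl

end RunningReward

/-! ### The Feynman–Kac formula -/

section FeynmanKac

variable {S : Type*} [Fintype S] [DecidableEq S] {T : ℝ≥0} {D : Matrix S S ℝ} {x : S}
  {p : Measure (CadlagPath S T)}

lemma Matrix.exp_smul_diagonal_mulVec (h : ℝ) (U g : S → ℝ) :
    NormedSpace.exp (h • Matrix.diagonal U) *ᵥ g = fun y => Real.exp (h * U y) * g y := by
  rw [← Matrix.diagonal_smul, Matrix.exp_diagonal]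
  ext y
  rw [Matrix.mulVec_diagonal, Pi.coe_exp, Real.exp_eq_exp_ℝ]
  rfl

lemma IsMarkovLaw.nonempty_path (hp : IsMarkovLaw D x T p) : Nonempty (CadlagPath S T) :=
  have := hp.isProbabilityMeasure
  nonempty_of_isProbabilityMeasure p

/-- The Feynman–Kac formula for a Riemann sum of the reward. -/
lemma IsMarkovLaw.integral_mul_exp_riemannSum (hD : ∀ i j, i ≠ j → 0 ≤ D i j)
    (hp : IsMarkovLaw D x T p) (U : S → ℝ) {s : Set.Icc (0 : ℝ) T}
    {Φ : CadlagPath S T → ℝ} (hΦ : Measurable[pathPast S s] Φ) {C : ℝ} (hC : ∀ ω, |Φ ω| ≤ C)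
    {h : ℝ} (hh : 0 ≤ h) (N : ℕ) (hN : (s : ℝ) + N * h ≤ T) (g : S → ℝ) :
    ∫ ω, Φ ω * (Real.exp (∑ j ∈ Finset.range N, h * U (ω.at (s + (j + 1 : ℕ) * h))) *
        g (ω.at (s + N * h))) ∂p =
      ∫ ω, Φ ω * ((NormedSpace.exp (h • D) * NormedSpace.exp (h • Matrix.diagonal U)) ^ N *ᵥ g)
        (ω s) ∂p := by
  induction N generalizing g with
  | zero => simp [CadlagPath.at_coe]
  | succ N ih =>
    obtain ⟨CU, hCU0, hCU⟩ := exists_abs_le_of_finite U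
    have hC0 : 0 ≤ C := (abs_nonneg _).trans (hC (Classical.choice
      hp.nonempty_path))
    have hs0 : (0 : ℝ) ≤ s := s.2.1
    have hNh : 0 ≤ (N : ℝ) * h := by positivity
    have hN1 : (s : ℝ) + N * h ≤ T := by
      push_cast at hN
      linarith
    let a : Set.Icc (0 : ℝ) T := ⟨s + N * h, by linarith, hN1⟩
    let b : Set.Icc (0 : ℝ) T := ⟨s + (N + 1 : ℕ) * h, by push_cast; linarith, hN⟩
    have hab : a ≤ b := by
      show (s : ℝ) + N * h ≤ s + (N + 1 : ℕ) * h
      push_cast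
      linarith
    have hsa : s ≤ a := by
      show (s : ℝ) ≤ s + N * h
      linarith
    have hba : (b : ℝ) - a = h := by
      show (s : ℝ) + (N + 1 : ℕ) * h - (s + N * h) = h
      push_cast
      ring
    set E : CadlagPath S T → ℝ := fun ω =>
      Real.exp (∑ j ∈ Finset.range N, h * U (ω.at (s + (j + 1 : ℕ) * h))) with hE
    have hEm : Measurable[pathPast S a] E :=
      Real.measurable_exp.comp (measurable_riemannSum_pathPast U hh (b := a) le_rfl)
    have hEb : ∀ ω, |E ω| ≤ Real.exp (N * (h * CU)) := fun ω => by
      rw [hE, Real.abs_exp, Real.exp_le_exp]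
      refine (Finset.sum_le_card_nsmul (Finset.range N) _ (h * CU) fun j _ => ?_).trans
        (by simp)
      exact mul_le_mul_of_nonneg_left ((le_abs_self _).trans (hCU _)) hh
    have hΦE : Measurable[pathPast S a] fun ω => Φ ω * E ω :=
      (hΦ.mono (pathPast_mono hsa) le_rfl).mul hEm
    have hΦEb : ∀ ω, |Φ ω * E ω| ≤ C * Real.exp (N * (h * CU)) := fun ω => by
      rw [abs_mul]
      exact mul_le_mul (hC ω) (hEb ω) (abs_nonneg _) hC0
    -- The last step is peeled off: the first `N` rewards belong to the past of `a`, and the reward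
    -- sampled at the right endpoint `b` is absorbed into `g`, which becomes `e^{hD} e^{hU} g`.
    have hstep := hp.integral_mul_comp_eval hD hab (fun y => Real.exp (h * U y) * g y) hΦE hΦEb
    rw [hba, ← Matrix.exp_smul_diagonal_mulVec, Matrix.mulVec_mulVec] at hstep
    rw [pow_succ, ← Matrix.mulVec_mulVec, ← ih hN1]
    refine Eq.trans ?_ (hstep.trans ?_)
    · refine integral_congr_ae (.of_forall fun ω => ?_)
      simp only [Finset.sum_range_succ, Real.exp_add, hE]
      rw [← ω.at_coe b]
      ring
    · refine integral_congr_ae (.of_forall fun ω => ?_)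
      simp only [hE]
      rw [← ω.at_coe a]
      ring

/-- The Feynman–Kac formula. -/
lemma IsMarkovLaw.feynmanKac (hD : ∀ i j, i ≠ j → 0 ≤ D i j) (hp : IsMarkovLaw D x T p)
    (U : S → ℝ) {s t : Set.Icc (0 : ℝ) T} (hst : s ≤ t)
    {Φ : CadlagPath S T → ℝ} (hΦ : Measurable[pathPast S s] Φ) {C : ℝ} (hC : ∀ ω, |Φ ω| ≤ C)
    (g : S → ℝ) :
    ∫ ω, Φ ω * (Real.exp (reward U s t ω) * g (ω t)) ∂p =
      ∫ ω, Φ ω * (NormedSpace.exp (((t : ℝ) - s) • (D + Matrix.diagonal U)) *ᵥ g) (ω s) ∂p := by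
  have := hp.isProbabilityMeasure
  have hC0 : 0 ≤ C := (abs_nonneg _).trans (hC (Classical.choice
    hp.nonempty_path))
  obtain ⟨CU, hCU0, hCU⟩ := exists_abs_le_of_finite U
  obtain ⟨Cg, hCg0, hCg⟩ := exists_abs_le_of_finite g
  have hst' : (s : ℝ) ≤ t := hst
  have hΦ' : Measurable Φ := hΦ.mono (pathPast_le s) le_rfl
  set τ := (t : ℝ) - s with hτ
  have hτ0 : 0 ≤ τ := sub_nonneg.mpr hst'
  set R : ℕ → CadlagPath S T → ℝ := fun N ω =>
    ∑ j ∈ Finset.range N, τ / N * U (ω.at (s + (j + 1 : ℕ) * (τ / N))) with hR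
  -- For `N = 0` the grid stays at `s`, hence the restriction here and below.
  have hend : ∀ N : ℕ, N ≠ 0 → (s : ℝ) + N * (τ / N) = t := fun N hN => by
    rw [mul_div_cancel₀ _ (Nat.cast_ne_zero.mpr hN)]
    linarith
  have hRm : ∀ N, N ≠ 0 → Measurable (R N) := fun N hN =>
    (measurable_riemannSum_pathPast (b := t) U (div_nonneg hτ0 N.cast_nonneg)
      (hend N hN).le).mono (pathPast_le t) le_rfl
  have hRb : ∀ N, N ≠ 0 → ∀ ω, R N ω ≤ τ * CU := fun N hN ω => by
    refine (Finset.sum_le_card_nsmul (Finset.range N) _ (τ / N * CU) fun j _ => ?_).trans ?_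
    · exact mul_le_mul_of_nonneg_left ((le_abs_self _).trans (hCU _))
        (div_nonneg hτ0 N.cast_nonneg)
    · rw [Finset.card_range, nsmul_eq_mul, ← mul_assoc, mul_div_cancel₀ _ (Nat.cast_ne_zero.mpr hN)]
  have hleft : Tendsto (fun N : ℕ => ∫ ω, Φ ω * (Real.exp (R N ω) * g (ω t)) ∂p) atTop
      (𝓝 (∫ ω, Φ ω * (Real.exp (reward U s t ω) * g (ω t)) ∂p)) := by
    refine tendsto_integral_filter_of_dominated_convergence
      (fun _ => C * (Real.exp (τ * CU) * Cg)) ?_ ?_ (integrable_const _) ?_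
    · filter_upwards [eventually_ne_atTop 0] with N hN
      exact (hΦ'.mul ((Real.measurable_exp.comp (hRm N hN)).mul
        (measurable_comp_eval t g))).aestronglyMeasurable
    · filter_upwards [eventually_ne_atTop 0] with N hN
      refine .of_forall fun ω => ?_
      rw [norm_mul, norm_mul, Real.norm_eq_abs, Real.norm_eq_abs, Real.norm_eq_abs, Real.abs_exp]
      have h1 := Real.exp_le_exp.mpr (hRb N hN ω)
      exact mul_le_mul (hC ω) (mul_le_mul h1 (hCg _) (abs_nonneg _) (Real.exp_nonneg _))
        (by positivity) hC0
    · refine .of_forall fun ω => Tendsto.const_mul _ (Tendsto.mul_const _ ?_)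
      exact (Real.continuous_exp.tendsto _).comp
        (tendsto_riemannSum (tendsto_comp_at U ω) (fun r => hCU _) hst')
  have hright : Tendsto (fun N : ℕ => ∫ ω, Φ ω * ((NormedSpace.exp ((τ / N) • D) *
        NormedSpace.exp ((τ / N) • Matrix.diagonal U)) ^ N *ᵥ g) (ω s) ∂p) atTop
      (𝓝 (∫ ω, Φ ω * (NormedSpace.exp (τ • (D + Matrix.diagonal U)) *ᵥ g) (ω s) ∂p)) := by
    simp only [_root_.integral_mul_comp_eval hΦ' hC s]
    refine tendsto_finsetSum _ fun z _ => Tendsto.mul_const _ ?_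
    have h1 := Matrix.tendsto_exp_mul_exp_pow (τ • D) (τ • Matrix.diagonal U)
    simp only [smul_smul, ← smul_add] at h1
    have h2 : Continuous fun A : Matrix S S ℝ => (A *ᵥ g) z :=
      (continuous_apply z).comp (continuous_id.matrix_mulVec continuous_const)
    have h3 := (h2.tendsto _).comp h1
    refine h3.congr fun N => ?_
    simp only [Function.comp_apply, div_eq_inv_mul]
  refine tendsto_nhds_unique hleft (hright.congr' ?_)
  filter_upwards [eventually_ne_atTop 0] with N hN
  rw [← hp.integral_mul_exp_riemannSum hD U hΦ hC (div_nonneg hτ0 N.cast_nonneg) N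
    ((hend N hN).trans_le t.2.2), hend N hN]
  simp only [CadlagPath.at_coe, hR]

end FeynmanKac

/-! ### The Gibbs variational principle -/

section GibbsVariational

variable {Ω : Type*} [MeasurableSpace Ω] {p q : Measure Ω} [IsProbabilityMeasure p] {f : Ω → ℝ}
  {C : ℝ}

lemma integrable_exp_of_abs_le (hf : Measurable f) (hC : ∀ ω, |f ω| ≤ C) :
    Integrable (fun ω => Real.exp (f ω)) p :=
  integrable_of_measurable_of_abs_le (Real.measurable_exp.comp hf) (C := Real.exp C) fun ω => by
    rw [Real.abs_exp, Real.exp_le_exp]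
    exact (le_abs_self _).trans (hC ω)

/-- The Gibbs (Donsker–Varadhan) inequality. -/
lemma integral_sub_klDiv_le_log_integral_exp [IsProbabilityMeasure q] (hf : Measurable f)
    (hC : ∀ ω, |f ω| ≤ C) :
    ((∫ ω, f ω ∂q : ℝ) : EReal) - ((InformationTheory.klDiv q p : ℝ≥0∞) : EReal) ≤
      ((Real.log (∫ ω, Real.exp (f ω) ∂p) : ℝ) : EReal) := by
  by_cases htop : InformationTheory.klDiv q p = ∞
  · rw [htop, EReal.coe_ennreal_top, EReal.sub_top]
    exact bot_le
  obtain ⟨hac, hint⟩ := InformationTheory.klDiv_ne_top_iff.mp htop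
  have hexp : Integrable (fun ω => Real.exp (f ω)) p := integrable_exp_of_abs_le hf hC
  have hfq : Integrable f q := integrable_of_measurable_of_abs_le hf hC
  have := isProbabilityMeasure_tilted hexp
  have hacf : q ≪ p.tilted f := hac.trans (absolutelyContinuous_tilted hexp)
  -- The divergence of `q` from the tilt equals `D(q‖p) - E_q[f] + log E_p[e^f]`; its nonnegativity
  -- is the claim.
  have h1 := InformationTheory.toReal_klDiv_of_measure_eq hacf (by simp)
  rw [integral_llr_tilted_right hac hfq hexp hint,
    ← InformationTheory.toReal_klDiv_of_measure_eq hac (by simp)] at h1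
  have h2 : 0 ≤ (InformationTheory.klDiv q (p.tilted f)).toReal := ENNReal.toReal_nonneg
  rw [← EReal.coe_ennreal_toReal htop, ← EReal.coe_sub, EReal.coe_le_coe_iff]
  linarith

/-- The log-density of the tilt is `f` minus the logarithm of the normalizing constant. -/
lemma klDiv_tilted_self (hf : Measurable f) (hC : ∀ ω, |f ω| ≤ C) :
    ((InformationTheory.klDiv (p.tilted f) p : ℝ≥0∞) : EReal) =
      ((∫ ω, f ω ∂(p.tilted f) - Real.log (∫ ω, Real.exp (f ω) ∂p) : ℝ) : EReal) := by
  have hexp : Integrable (fun ω => Real.exp (f ω)) p := integrable_exp_of_abs_le hf hC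
  have := isProbabilityMeasure_tilted hexp
  have hac := tilted_absolutelyContinuous p f
  have hllr : llr (p.tilted f) p =ᵐ[p.tilted f]
      fun ω => f ω - Real.log (∫ ω, Real.exp (f ω) ∂p) := by
    refine hac.ae_le ?_
    filter_upwards [llr_tilted_left Measure.AbsolutelyContinuous.rfl hexp hf.aemeasurable,
      llr_self p] with ω h1 h2
    rw [h1, h2, Pi.zero_apply, add_zero]
  have hf' : Integrable f (p.tilted f) := integrable_of_measurable_of_abs_le hf hC
  have hint : Integrable (llr (p.tilted f) p) (p.tilted f) :=
    (hf'.sub (integrable_const _)).congr hllr.symm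
  rw [← EReal.coe_ennreal_toReal (InformationTheory.klDiv_ne_top hac hint),
    InformationTheory.toReal_klDiv_of_measure_eq hac (by simp), integral_congr_ae hllr,
    integral_sub hf' (integrable_const _)]
  simp

end GibbsVariational

/-! ### The twisted Markov law as a tilt of the original law -/

section TwistedLaw

variable {S : Type*} [Fintype S] [DecidableEq S] {T : ℝ≥0} {D : Matrix S S ℝ} {x : S}
  {p : Measure (CadlagPath S T)}

omit [Fintype S] [DecidableEq S] in
lemma measurableSet_cylinder_pathPast {n : ℕ} {t : Fin (n + 1) → Set.Icc (0 : ℝ) T}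
    (ht : Monotone t) (y : Fin (n + 1) → S) : MeasurableSet[pathPast S (t (Fin.last n))]
      {ω : CadlagPath S T | ∀ i, ω (t i) = y i} := by
  rw [Set.ofPred_forall]
  exact @MeasurableSet.iInter _ _ (pathPast S (t (Fin.last n))) _ _ fun i =>
    measurableSet_eval_eq_pathPast (ht (Fin.le_last i)) (y i)

omit [DecidableEq S] in
lemma measurable_indicator_exp_reward {n : ℕ} {t : Fin (n + 1) → Set.Icc (0 : ℝ) T}
    (ht : Monotone t) (y : Fin (n + 1) → S) (U : S → ℝ) :
    Measurable[pathPast S (t (Fin.last n))]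
      ({ω : CadlagPath S T | ∀ i, ω (t i) = y i}.indicator
        fun ω => Real.exp (reward U 0 (t (Fin.last n)) ω)) :=
  Measurable.indicator
    (Real.measurable_exp.comp (measurable_reward_pathPast U (t (Fin.last n)).2.1))
    (measurableSet_cylinder_pathPast ht y)

omit [DecidableEq S] in
lemma exists_abs_indicator_exp_reward_le (A : Set (CadlagPath S T)) (U : S → ℝ) (a b : ℝ) :
    ∃ C, ∀ ω, |A.indicator (fun ω => Real.exp (reward U a b ω)) ω| ≤ C := by
  obtain ⟨C, -, hC⟩ := exists_abs_le_of_finite U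
  refine ⟨Real.exp (C * |b - a|), fun ω => ?_⟩
  rw [abs_of_nonneg (Set.indicator_nonneg (fun _ _ => Real.exp_nonneg _) ω)]
  refine Set.indicator_le' (g := fun _ => Real.exp (C * |b - a|)) (fun ω _ => ?_)
    (fun _ _ => Real.exp_nonneg _) ω
  exact Real.exp_le_exp.mpr ((le_abs_self _).trans (abs_reward_le hC a b ω))

/-- The finite-dimensional distributions weighted by the exponential reward. -/
lemma IsMarkovLaw.integral_indicator_exp_reward (hD : ∀ i j, i ≠ j → 0 ≤ D i j)
    (hp : IsMarkovLaw D x T p) (U : S → ℝ) (n : ℕ) (t : Fin (n + 1) → Set.Icc (0 : ℝ) T)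
    (y : Fin (n + 1) → S) (ht : Monotone t) (ht0 : t 0 = startTime T) :
    ∫ ω, {ω : CadlagPath S T | ∀ i, ω (t i) = y i}.indicator
        (fun ω => Real.exp (reward U 0 (t (Fin.last n)) ω)) ω ∂p =
      (if y 0 = x then 1 else 0) * ∏ i : Fin n,
        NormedSpace.exp (((t i.succ : ℝ) - (t i.castSucc : ℝ)) • (D + Matrix.diagonal U))
          (y i.castSucc) (y i.succ) := by
  have := hp.isProbabilityMeasure
  induction n with
  | zero =>
    have e : ∀ ω : CadlagPath S T, {ω : CadlagPath S T | ∀ i, ω (t i) = y i}.indicator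
        (fun ω => Real.exp (reward U 0 (t (Fin.last 0)) ω)) ω =
        {ω : CadlagPath S T | ω (startTime T) = y 0}.indicator 1 ω := by
      intro ω
      simp [Set.indicator_apply, ht0, Fin.forall_fin_one, reward, startTime]
    simp only [e]
    rw [integral_indicator_one (measurableSet_eval_eq _ _), measureReal_def, hp.measure_startTime]
    split_ifs <;> simp
  | succ n ih =>
    have ht' : Monotone fun i : Fin (n + 1) => t i.castSucc := fun i j hij =>
      ht (Fin.castSucc_le_castSucc_iff.mpr hij)
    have hle : t (Fin.last n).castSucc ≤ t (Fin.last (n + 1)) := ht (Fin.le_last _)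
    obtain ⟨C, hC⟩ := exists_abs_indicator_exp_reward_le
      {ω : CadlagPath S T | ∀ i : Fin (n + 1), ω (t i.castSucc) = y i.castSucc} U 0
        (t (Fin.last n).castSucc)
    -- Feynman–Kac over the last interval: `Φ` carries the earlier states and reward, and `g` is the
    -- indicator of the last state, so that `e^{τ(D+U)} g` is a single matrix entry.
    have hFK := hp.feynmanKac hD U hle (measurable_indicator_exp_reward ht'
      (fun i => y i.castSucc) U) hC (fun z => if z = y (Fin.last (n + 1)) then 1 else 0)
    have h1 := ih (fun i => t i.castSucc) (fun i => y i.castSucc) ht' ht0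
    rw [Fin.prod_univ_castSucc, ← mul_assoc]
    refine Eq.trans ?_ (congrArg (fun c : ℝ => c * NormedSpace.exp (((t (Fin.last (n + 1)) : ℝ) -
      t (Fin.last n).castSucc) • (D + Matrix.diagonal U)) (y (Fin.last n).castSucc)
        (y (Fin.last (n + 1)))) h1)
    rw [← integral_mul_const]
    refine Eq.trans (integral_congr_ae (.of_forall fun ω => ?_))
      (hFK.trans (integral_congr_ae (.of_forall fun ω => ?_)))
    · simp only [Set.indicator_apply, Set.mem_ofPred_eq, Fin.forall_fin_succ' (n := n + 1)]
      by_cases h2 : ∀ i : Fin (n + 1), ω (t i.castSucc) = y i.castSucc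
      · by_cases h3 : ω (t (Fin.last (n + 1))) = y (Fin.last (n + 1))
        · simp only [h2, h3, implies_true, and_self, if_true, mul_one]
          rw [← Real.exp_add, reward_add]
        · simp [h3]
      · simp [h2]
    · by_cases h2 : ∀ i : Fin (n + 1), ω (t i.castSucc) = y i.castSucc
      · simp [Matrix.mulVec, dotProduct, h2]
      · simp [h2]

/-- The ratios of `v` and the factors `e^{-τΛ}` telescope along the chain. -/
lemma prod_exp_twistedGenerator {U v : S → ℝ} {Λ : ℝ} (hv : ∀ y, 0 < v y) (n : ℕ)
    (t : Fin (n + 1) → ℝ) (y : Fin (n + 1) → S) :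
    ∏ i : Fin n, NormedSpace.exp ((t i.succ - t i.castSucc) • twistedGenerator D U Λ v)
        (y i.castSucc) (y i.succ) =
      (∏ i : Fin n, NormedSpace.exp ((t i.succ - t i.castSucc) • (D + Matrix.diagonal U))
        (y i.castSucc) (y i.succ)) *
      (Real.exp (-((t (Fin.last n) - t 0) * Λ)) * (v (y (Fin.last n)) / v (y 0))) := by
  induction n with
  | zero => simp [(hv _).ne']
  | succ n ih =>
    have h1 := ih (fun i => t i.castSucc) (fun i => y i.castSucc)
    rw [Fin.prod_univ_castSucc, Fin.prod_univ_castSucc]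
    simp only [Fin.castSucc_zero, Fin.succ_castSucc, Fin.succ_last] at h1 ⊢
    rw [h1, exp_smul_twistedGenerator_apply hv]
    have h2 : Real.exp (-((t (Fin.last (n + 1)) - t 0) * Λ)) =
        Real.exp (-((t (Fin.last n).castSucc - t 0) * Λ)) *
          Real.exp (-((t (Fin.last (n + 1)) - t (Fin.last n).castSucc) * Λ)) := by
      rw [← Real.exp_add]
      ring_nf
    rw [h2]
    have h3 := (hv (y (Fin.last n).castSucc)).ne'
    have h4 := (hv (y 0)).ne'
    field_simp

/-- The log-density, up to normalization, of the twisted law with respect to the original one. -/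
noncomputable def twistPotential (U v : S → ℝ) (ω : CadlagPath S T) : ℝ :=
  reward U 0 T ω + Real.log (v (ω (endTime T)))

omit [DecidableEq S] in
lemma measurable_twistPotential (U v : S → ℝ) :
    Measurable (twistPotential U v : CadlagPath S T → ℝ) :=
  (measurable_reward U (b := endTime T) T.coe_nonneg).add
    (measurable_comp_eval (endTime T) fun y => Real.log (v y))

omit [DecidableEq S] in
lemma exists_abs_twistPotential_le (U v : S → ℝ) :
    ∃ C, ∀ ω : CadlagPath S T, |twistPotential U v ω| ≤ C := by
  obtain ⟨CU, -, hCU⟩ := exists_abs_le_of_finite U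
  obtain ⟨Cv, -, hCv⟩ := exists_abs_le_of_finite fun y => Real.log (v y)
  exact ⟨_, fun ω => (abs_add_le _ _).trans (add_le_add (abs_reward_le hCU _ _ ω) (hCv _))⟩

omit [Fintype S] [DecidableEq S] in
lemma exp_twistPotential {U v : S → ℝ} (hv : ∀ y, 0 < v y) (ω : CadlagPath S T) :
    Real.exp (twistPotential U v ω) = Real.exp (reward U 0 T ω) * v (ω (endTime T)) := by
  rw [twistPotential, Real.exp_add, Real.exp_log (hv _)]

/-- On an eigenvector the Feynman–Kac semigroup is a scalar, so the reward after time `s` integrates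
out. -/
lemma IsMarkovLaw.integral_mul_exp_reward_mul_eigenvector (hD : ∀ i j, i ≠ j → 0 ≤ D i j)
    (hp : IsMarkovLaw D x T p) {U v : S → ℝ} {Λ : ℝ}
    (hDv : (D + Matrix.diagonal U) *ᵥ v = Λ • v) (s : Set.Icc (0 : ℝ) T)
    {Φ : CadlagPath S T → ℝ} (hΦ : Measurable[pathPast S s] Φ) {C : ℝ} (hC : ∀ ω, |Φ ω| ≤ C) :
    ∫ ω, Φ ω * (Real.exp (reward U s T ω) * v (ω (endTime T))) ∂p =
      ∫ ω, Φ ω * (Real.exp ((T - s) * Λ) * v (ω s)) ∂p := by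
  have h := hp.feynmanKac hD U (le_endTime s) hΦ hC v
  rw [Matrix.exp_mulVec_of_eigenvector (r := ((endTime T : ℝ) - s) * Λ)
    (by rw [Matrix.smul_mulVec, hDv, smul_smul])] at h
  exact h

lemma IsMarkovLaw.integral_exp_twistPotential (hD : ∀ i j, i ≠ j → 0 ≤ D i j)
    (hp : IsMarkovLaw D x T p) {U v : S → ℝ} {Λ : ℝ} (hv : ∀ y, 0 < v y)
    (hDv : (D + Matrix.diagonal U) *ᵥ v = Λ • v) :
    ∫ ω, Real.exp (twistPotential U v ω) ∂p = Real.exp (T * Λ) * v x := by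
  have := hp.isProbabilityMeasure
  have h := hp.integral_mul_exp_reward_mul_eigenvector hD hDv (startTime T) (Φ := fun _ => 1)
    measurable_const (C := 1) (by simp)
  simp only [one_mul] at h
  simp only [exp_twistPotential hv]
  refine h.trans ((integral_congr_ae (g := fun _ => Real.exp (T * Λ) * v x) ?_).trans (by simp))
  filter_upwards [hp.ae_startTime_eq] with ω hω
  change Real.exp ((T - 0) * Λ) * v (ω (startTime T)) = _
  rw [hω, sub_zero]

/-- Tilting the law of a Markov process by its exponential reward and a positive eigenvector gives
the law of the Markov process with the twisted generator. -/
lemma IsMarkovLaw.tilted_twistPotential (hD : ∀ i j, i ≠ j → 0 ≤ D i j)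
    (hp : IsMarkovLaw D x T p) {U v : S → ℝ} {Λ : ℝ} (hv : ∀ y, 0 < v y)
    (hDv : (D + Matrix.diagonal U) *ᵥ v = Λ • v) :
    IsMarkovLaw (twistedGenerator D U Λ v) x T (p.tilted (twistPotential U v)) := by
  intro n t y ht ht0
  have := hp.isProbabilityMeasure
  set A := {ω : CadlagPath S T | ∀ i, ω (t i) = y i} with hA
  set s := t (Fin.last n) with hs
  have hAm : MeasurableSet A := pathPast_le _ _ (measurableSet_cylinder_pathPast ht y)
  obtain ⟨C, hC⟩ := exists_abs_indicator_exp_reward_le A U 0 s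
  have h1 := hp.integral_mul_exp_reward_mul_eigenvector hD hDv s
    (measurable_indicator_exp_reward ht y U) hC
  simp only [← hA, ← hs] at h1
  -- The cylinder `A` is decided by time `s`, where the state is `y (Fin.last n)`; only the reward
  -- up to `s` remains inside the integral.
  have h2 : ∫ ω in A, Real.exp (twistPotential U v ω) ∂p =
      Real.exp ((T - s) * Λ) * v (y (Fin.last n)) *
        ∫ ω, A.indicator (fun ω => Real.exp (reward U 0 s ω)) ω ∂p := by
    rw [← integral_const_mul, ← integral_indicator hAm]
    refine Eq.trans (integral_congr_ae (.of_forall fun ω => ?_))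
      (h1.trans (integral_congr_ae (.of_forall fun ω => ?_)))
    · by_cases hω : ω ∈ A
      · simp only [Set.indicator_of_mem hω]
        rw [exp_twistPotential hv, ← mul_assoc, ← Real.exp_add, reward_add]
      · simp only [Set.indicator_of_notMem hω, zero_mul]
    · by_cases hω : ω ∈ A
      · simp only [Set.indicator_of_mem hω]
        rw [show ω s = y (Fin.last n) from hω _]
        ring
      · simp only [Set.indicator_of_notMem hω, zero_mul, mul_zero]
  rw [tilted_apply_eq_ofReal_integral' _ hAm, integral_div, h2,
    hp.integral_exp_twistPotential hD hv hDv, hp.integral_indicator_exp_reward hD U n t y ht ht0,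
    prod_exp_twistedGenerator (D := D) hv n (fun i => (t i : ℝ)) y]
  congr 1
  -- Only `y 0 = x` contributes, and then `v (y 0)` is the factor `v x` of the normalizing constant.
  split_ifs with hy
  · have h3 : ((t 0 : Set.Icc (0 : ℝ) T) : ℝ) = 0 := by rw [ht0]; rfl
    have h4 : Real.exp (T * Λ) = Real.exp ((T - s) * Λ) * Real.exp (s * Λ) := by
      rw [← Real.exp_add]
      ring_nf
    rw [h3, sub_zero, Real.exp_neg, h4, hy, ← hs]
    have h5 := (hv x).ne'
    field_simp
  · simp

end TwistedLaw

/-! ### Optimal welfare, welfare of the twisted law, and averages -/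

section Welfare

variable {S : Type*} [Fintype S] [DecidableEq S] {T : ℝ≥0} {D : Matrix S S ℝ} {x : S}
  {p : Measure (CadlagPath S T)} {U v : S → ℝ} {Λ : ℝ}

omit [DecidableEq S] in
lemma measurable_totalReward (U : S → ℝ) :
    Measurable (reward U 0 T : CadlagPath S T → ℝ) :=
  measurable_reward U (b := endTime T) T.coe_nonneg

omit [DecidableEq S] in
lemma exists_abs_totalReward_le (U : S → ℝ) :
    ∃ C, ∀ ω : CadlagPath S T, |reward U 0 T ω| ≤ C := by
  obtain ⟨CU, -, hCU⟩ := exists_abs_le_of_finite U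
  exact ⟨_, abs_reward_le hCU _ _⟩

omit [DecidableEq S] in
lemma welfare_le_log_integral_exp [IsProbabilityMeasure p] (U : S → ℝ)
    (q : Measure (CadlagPath S T)) [IsProbabilityMeasure q] :
    welfare U p q ≤ ((Real.log (∫ ω, Real.exp (reward U 0 T ω) ∂p) : ℝ) : EReal) := by
  obtain ⟨C, hC⟩ := exists_abs_totalReward_le (T := T) U
  exact integral_sub_klDiv_le_log_integral_exp (measurable_totalReward U) hC

omit [DecidableEq S] in
lemma welfare_tilted_reward [IsProbabilityMeasure p] (U : S → ℝ) :
    welfare U p (p.tilted (reward U 0 T)) =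
      ((Real.log (∫ ω, Real.exp (reward U 0 T ω) ∂p) : ℝ) : EReal) := by
  obtain ⟨C, hC⟩ := exists_abs_totalReward_le (T := T) U
  rw [welfare, klDiv_tilted_self (measurable_totalReward U) hC, ← EReal.coe_sub]
  exact congrArg _ (sub_sub_cancel _ _)

omit [DecidableEq S] in
lemma isWelfareOptimal_tilted_reward [IsProbabilityMeasure p] (U : S → ℝ) :
    IsWelfareOptimal U p (p.tilted (reward U 0 T)) := by
  obtain ⟨C, hC⟩ := exists_abs_totalReward_le (T := T) U
  refine ⟨isProbabilityMeasure_tilted (integrable_exp_of_abs_le (measurable_totalReward U) hC),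
    fun q hq => ?_⟩
  rw [welfare_tilted_reward]
  exact welfare_le_log_integral_exp U q

omit [DecidableEq S] in
lemma IsWelfareOptimal.welfare_eq [IsProbabilityMeasure p] {q : Measure (CadlagPath S T)}
    (hq : IsWelfareOptimal U p q) :
    welfare U p q = ((Real.log (∫ ω, Real.exp (reward U 0 T ω) ∂p) : ℝ) : EReal) := by
  have := hq.1
  refine le_antisymm (welfare_le_log_integral_exp U q) ?_
  rw [← welfare_tilted_reward]
  exact hq.2 _ (isWelfareOptimal_tilted_reward U).1

/-- Inserting the weight `v(X_T)` makes the expectation exactly `e^{TΛ} v(x)`. One `C` pays for this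
weight and the other for `log v(x)`. -/
lemma IsMarkovLaw.abs_log_integral_exp_reward_sub_le (hD : ∀ i j, i ≠ j → 0 ≤ D i j)
    (hp : IsMarkovLaw D x T p) (hv : ∀ y, 0 < v y)
    (hDv : (D + Matrix.diagonal U) *ᵥ v = Λ • v) {C : ℝ} (hC : ∀ y, |Real.log (v y)| ≤ C) :
    |Real.log (∫ ω, Real.exp (reward U 0 T ω) ∂p) - T * Λ| ≤ 2 * C := by
  have := hp.isProbabilityMeasure
  obtain ⟨CI, hCI⟩ := exists_abs_totalReward_le (T := T) U
  have hI := integrable_exp_of_abs_le (p := p) (measurable_totalReward U) hCI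
  obtain ⟨CF, hCF⟩ := exists_abs_twistPotential_le (T := T) U v
  have hF := integrable_exp_of_abs_le (p := p) (measurable_twistPotential U v) hCF
  have hpos : 0 < ∫ ω, Real.exp (reward U 0 T ω) ∂p := integral_exp_pos hI
  have h1 := hp.integral_exp_twistPotential hD hv hDv
  have h2 : Real.log (∫ ω, Real.exp (twistPotential U v ω) ∂p) = T * Λ + Real.log (v x) := by
    rw [h1, Real.log_mul (Real.exp_pos _).ne' (hv x).ne', Real.log_exp]
  have hpos' : 0 < ∫ ω, Real.exp (twistPotential U v ω) ∂p := integral_exp_pos hF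
  have hle : ∫ ω, Real.exp (reward U 0 T ω) ∂p ≤
      Real.exp C * ∫ ω, Real.exp (twistPotential U v ω) ∂p := by
    rw [← integral_const_mul]
    refine integral_mono hI (hF.const_mul _) fun ω => ?_
    rw [← Real.exp_add, Real.exp_le_exp, twistPotential]
    linarith [(abs_le.mp (hC (ω (endTime T)))).1]
  have hge : ∫ ω, Real.exp (twistPotential U v ω) ∂p ≤
      Real.exp C * ∫ ω, Real.exp (reward U 0 T ω) ∂p := by
    rw [← integral_const_mul]
    refine integral_mono hF (hI.const_mul _) fun ω => ?_
    rw [← Real.exp_add, Real.exp_le_exp, twistPotential]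
    linarith [(abs_le.mp (hC (ω (endTime T)))).2]
  have h3 := Real.log_le_log hpos hle
  have h4 := Real.log_le_log hpos' hge
  rw [Real.log_mul (Real.exp_pos _).ne' hpos'.ne', Real.log_exp] at h3
  rw [Real.log_mul (Real.exp_pos _).ne' hpos.ne', Real.log_exp] at h4
  have h5 := abs_le.mp (hC x)
  rw [abs_le]
  constructor <;> linarith

/-- By uniqueness the law is the tilt by `twistPotential`, so its divergence is `E[∫ U] + E[log
v(X_T)] - TΛ - log v(x)`, and the expected reward cancels. -/
lemma IsMarkovLaw.welfare_twisted (hD : ∀ i j, i ≠ j → 0 ≤ D i j)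
    (hp : IsMarkovLaw D x T p) (hv : ∀ y, 0 < v y)
    (hDv : (D + Matrix.diagonal U) *ᵥ v = Λ • v) {q : Measure (CadlagPath S T)}
    (hq : IsMarkovLaw (twistedGenerator D U Λ v) x T q) :
    welfare U p q = ((T * Λ - ∫ ω, Real.log (v (ω (endTime T)) / v (ω (startTime T))) ∂q : ℝ) :
      EReal) := by
  have := hp.isProbabilityMeasure
  have := hq.isProbabilityMeasure
  have hq' := hq.unique (hp.tilted_twistPotential hD hv hDv)
  obtain ⟨CI, hCI⟩ := exists_abs_totalReward_le (T := T) U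
  obtain ⟨CF, hCF⟩ := exists_abs_twistPotential_le (T := T) U v
  have hkl := klDiv_tilted_self (p := p) (measurable_twistPotential U v) hCF
  rw [hp.integral_exp_twistPotential hD hv hDv, ← hq',
    Real.log_mul (Real.exp_pos _).ne' (hv x).ne', Real.log_exp] at hkl
  have hI : Integrable (reward U 0 T) q :=
    integrable_of_measurable_of_abs_le (measurable_totalReward U) hCI
  have hlog : Integrable (fun ω => Real.log (v (ω (endTime T)))) q :=
    integrable_comp_eval (endTime T) fun y => Real.log (v y)
  have h1 : ∫ ω, twistPotential U v ω ∂q =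
      ∫ ω, reward U 0 T ω ∂q + ∫ ω, Real.log (v (ω (endTime T))) ∂q := integral_add hI hlog
  have h2 : ∫ ω, Real.log (v (ω (endTime T)) / v (ω (startTime T))) ∂q =
      ∫ ω, Real.log (v (ω (endTime T))) ∂q - Real.log (v x) := by
    rw [integral_congr_ae (g := fun ω => Real.log (v (ω (endTime T))) - Real.log (v x)),
      integral_sub hlog (integrable_const _)]
    · simp
    · filter_upwards [hq.ae_startTime_eq] with ω hω
      rw [Real.log_div (hv _).ne' (hv _).ne', hω]
  rw [welfare, hkl, ← EReal.coe_sub, h1, h2]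
  congr 1
  change ∫ ω, reward U 0 T ω ∂q - _ = _
  ring

omit [Fintype S] [DecidableEq S] in
lemma hasAverageWelfare_of_abs_sub_le {p0 p : ∀ T : ℝ≥0, Measure (CadlagPath S T)}
    {w : ℝ≥0 → ℝ} {C : ℝ} (hw : ∀ T, welfare U (p0 T) (p T) = (w T : EReal))
    (hC : ∀ T : ℝ≥0, |w T - T * Λ| ≤ C) : HasAverageWelfare U p0 p Λ := by
  have h0 : Tendsto (fun T : ℝ≥0 => C / (T : ℝ)) atTop (𝓝 0) :=
    tendsto_const_nhds.div_atTop (NNReal.tendsto_coe_atTop.mpr tendsto_id)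
  have h1 : Tendsto (fun T : ℝ≥0 => w T / (T : ℝ)) atTop (𝓝 Λ) := by
    rw [tendsto_iff_norm_sub_tendsto_zero]
    refine squeeze_zero' (.of_forall fun _ => norm_nonneg _) ?_ h0
    filter_upwards [eventually_gt_atTop 0] with T hT
    have hT' : (0 : ℝ) < T := hT
    have e : w T / (T : ℝ) - Λ = (w T - T * Λ) / T := by field_simp
    rw [e, Real.norm_eq_abs, abs_div, abs_of_pos hT']
    exact div_le_div_of_nonneg_right (hC T) hT'.le
  refine ((continuous_coe_real_ereal.tendsto Λ).comp h1).congr fun T => ?_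
  rw [hw, Function.comp_apply, EReal.coe_div]

end Welfare

/-! ### The main theorem -/

theorem mainTheorem4 {S : Type*} [Fintype S] [DecidableEq S]
    (D : Matrix S S ℝ) (hD : IsRateMatrix D) (hirr : IsIrreducibleRate D)
    (U : S → ℝ) (x : S)
    (p0 : ∀ T : ℝ≥0, Measure (CadlagPath S T)) (hp0 : ∀ T, IsMarkovLaw D x T (p0 T))
    (Λ : ℝ) (hΛ : Λ = maxRealPart (D + Matrix.diagonal U)) :
    -- `Λ` is an eigenvalue of `D + I_U`, of maximal real part, with a positive eigenvector
    ((Λ : ℂ) ∈ spectrum ℂ ((D + Matrix.diagonal U).map (algebraMap ℝ ℂ)) ∧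
      (∀ μ ∈ spectrum ℂ ((D + Matrix.diagonal U).map (algebraMap ℝ ℂ)), μ.re ≤ Λ) ∧
      ∃ v : S → ℝ, (∀ y, 0 < v y) ∧ (D + Matrix.diagonal U) *ᵥ v = Λ • v) ∧
    -- (i) finite-horizon maximizers exist, and the limit of their average welfare is `Λ`
    ((∀ T, ∃ p, IsWelfareOptimal U (p0 T) p) ∧
      ∀ pstar : ∀ T : ℝ≥0, Measure (CadlagPath S T),
        (∀ T, IsWelfareOptimal U (p0 T) (pstar T)) → HasAverageWelfare U p0 pstar Λ) ∧
    ∀ v : S → ℝ, (∀ y, 0 < v y) → (D + Matrix.diagonal U) *ᵥ v = Λ • v →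
      -- (ii) the twisted matrix generates a Markov process, which attains the optimal average
      IsRateMatrix (twistedGenerator D U Λ v) ∧
      (∀ T, ∃! p, IsMarkovLaw (twistedGenerator D U Λ v) x T p) ∧
      ∀ pcheck : ∀ T : ℝ≥0, Measure (CadlagPath S T),
        (∀ T, IsMarkovLaw (twistedGenerator D U Λ v) x T (pcheck T)) →
          HasAverageWelfare U p0 pcheck Λ ∧
          -- (iii) its welfare on every finite horizon
          ∀ T : ℝ≥0, welfare U (p0 T) (pcheck T) =
            (((T : ℝ) * Λ -
              ∫ ω, Real.log (v (ω (endTime T)) / v (ω (startTime T))) ∂(pcheck T) : ℝ) :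
                EReal) := by
  classical
  have : Nonempty S := ⟨x⟩
  have hoff := hD.off_diag_nonneg
  have hoffU : ∀ i j, i ≠ j → 0 ≤ (D + Matrix.diagonal U) i j := fun i j hij => by
    simpa [hij] using hoff i j hij
  have hprob : ∀ T, IsProbabilityMeasure (p0 T) := fun T => (hp0 T).isProbabilityMeasure
  obtain ⟨r, v₀, hv₀, hr⟩ := exists_pos_eigenvector hD hirr U
  -- Positivity of the eigenvector forces its eigenvalue to be the largest real part.
  obtain rfl : r = Λ := by rw [hΛ, maxRealPart_eq_of_pos_eigenvector hoffU hv₀ hr]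
  refine ⟨⟨mem_spectrum_map_of_eigenvector (fun h => ?_) hr,
    fun μ hμ => re_le_of_pos_eigenvector hoffU hv₀ hr hμ, v₀, hv₀, hr⟩,
    ⟨fun T => ⟨_, isWelfareOptimal_tilted_reward U⟩, fun pstar hpstar => ?_⟩,
    fun v hv hDv => ⟨isRateMatrix_twistedGenerator hoff hv hDv, fun T =>
      ⟨_, (hp0 T).tilted_twistPotential hoff hv hDv, fun q hq =>
        hq.unique ((hp0 T).tilted_twistPotential hoff hv hDv)⟩, fun pcheck hpcheck => ?_⟩⟩
  · exact (hv₀ x).ne' (congrFun h x)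
  · obtain ⟨C, -, hC⟩ := exists_abs_le_of_finite fun y => Real.log (v₀ y)
    exact hasAverageWelfare_of_abs_sub_le (fun T => (hpstar T).welfare_eq)
      fun T => (hp0 T).abs_log_integral_exp_reward_sub_le hoff hv₀ hr hC
  · have hwelfare := fun T => (hp0 T).welfare_twisted hoff hv hDv (hpcheck T)
    refine ⟨?_, hwelfare⟩
    -- There are finitely many pairs of end states, so the correction term in (iii) is bounded
    -- uniformly in `T`.
    obtain ⟨C, -, hC⟩ := exists_abs_le_of_finite fun q : S × S => Real.log (v q.1 / v q.2)
    refine hasAverageWelfare_of_abs_sub_le (C := C) hwelfare fun T => ?_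
    have := (hpcheck T).isProbabilityMeasure
    rw [sub_sub_cancel_left, abs_neg]
    simpa using norm_integral_le_of_norm_le_const (μ := pcheck T)
      (f := fun ω => Real.log (v (ω (endTime T)) / v (ω (startTime T))))
      (.of_forall fun ω => hC (ω (endTime T), ω (startTime T)))
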